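/- Let $p$ be a prime and let $G$ be the Prüfer $p$-group (the Sylow $p$-subgroup of $\mathbb{Q}/\mathbb{Z}$, up to isomorphism), regarded as a Polish group with its Borel $\sigma$-algebra. Then any two subgroups $H,K$ of $G$ satisfy $H\subseteq K$ or $K\subseteq H$, and the following holds. Let $\{(X_i,Y_i)\}_{i\ge1}$ be mutually independent pairs of random variables, where $X_i$ is $G$-valued, $Y_i$ takes values in the set of cosets of finite normal subgroups of $G$ (with the discrete $\sigma$-algebra), and each $(X_i,Y_i)$ follows an erasure distribution: for each Borel set $B\subseteq G$, $P_{X_i|Y_i}(B)=|B\cap Y_i|/|Y_i|$ almost surely. Assume that for each finite normal subgroup $N$ of $G$ the limit $$Q(N)=\lim_{m\to\infty}\frac1m\sum_{i=1}^m\mathbb{P}\{Y_i\in G/N\}$$ exists, and that the upper entropy rate is finite: $\limsup_{m\to\infty}\frac1m\sum_{i=1}^m H(X_i\mid Y_i)<\infty$. Put $U_0^{(i)}=X_i$ and, for $n\ge1$, $k\ge0$ and $1\le j\le 2^{n-1}$, $$U_n^{(k2^n+2j-1)}=U_{n-1}^{(k2^n+j)}\,U_{n-1}^{(k2^n+j+2^{n-1})},\qquad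 U_n^{(k2^n+2j)}=U_{n-1}^{(k2^n+j+2^{n-1})}.$$ For a finite normal subgroup $N$ of $G$ define the conditional Shannon entropies (natural logarithm) $$H_n^{(i)}=H\big(U_n^{(i)}\mid\{U_n^{(j)}\}_{j<i},\{Y_j\}_{j\ge1}\big),\qquad H_n^{(i)}[N]=H\big(U_n^{(i)}N\mid\{U_n^{(j)}\}_{j<i},\{Y_j\}_{j\ge1}\big),$$ and for $\delta>0$ and $m\geq 1$ let $$F_{n,m}(N,\delta)=\frac1{m2^n}\Big|\Big\{1\le i\le m2^n:\ H_n^{(i)}[N]<\delta,\ \big|H_n^{(i)}-\log|N|\big|<\delta\Big\}\Big|.$$ Then for each finite normal subgroup $N$ of $G$ and each $0<\delta<\log p$, $$\lim_{n\to\infty}\liminf_{m\to\infty}F_{n,m}(N,\delta)=\lim_{n\to\infty}\limsup_{m\to\infty}F_{n,m}(N,\delta)=Q(N).$$ If moreover the pairs $(X_i,Y_i)$ are identically distributed, then $\lim_{m\to\infty}F_{n,m}(N,\delta)$ exists for every $n\ge0$, so that $\lim_{n\to\infty}\lim_{m\to\infty}F_{n,m}(N,\delta)=Q(N)$. Finally,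 this gives countably infinitely many polarization levels: the set of finite normal subgroups $N$ of $G$ is countably infinite, and there is a source satisfying all the assumptions above with $Q(N)>0$ for every finite normal subgroup $N$. -/

import Mathlib

open MeasureTheory ProbabilityTheory Filter Topology
open scoped ENNReal Pointwise

universe u v

/-- The Prüfer `p`-group: the `p`-primary part (Sylow `p`-subgroup) of `ℚ / ℤ`, i.e. the classes of
the rationals `m / p ^ n`. -/
abbrev Prufer (p : ℕ) : Type :=
  AddCommGroup.primaryComponent (ℚ ⧸ AddSubgroup.zmultiples (1 : ℚ)) p

/-- The conditional Shannon entropy (natural logarithm)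
`H(X | Y) = E[∑ₓ P_{X|Y}(x) log (1 / P_{X|Y}(x))]`, with values in `[0, ∞]`, where `P_{X|Y}` is the
regular conditional distribution of `X` given `Y`. It is meant for `X` conditionally discrete
given `Y`, which is automatic when `α` is countable. -/
noncomputable def condEntropy {Ω : Type*} [MeasurableSpace Ω] {α : Type*} [MeasurableSpace α]
    [StandardBorelSpace α] [Nonempty α] {β : Type*} [MeasurableSpace β]
    (X : Ω → α) (Y : Ω → β) (μ : Measure Ω) [IsFiniteMeasure μ] : ℝ≥0∞ :=
  ∫⁻ ω, ∑' x : α, ENNReal.ofReal (Real.negMulLog ((condDistrib X Y μ (Y ω)).real {x})) ∂μ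

/-- The cosets `g H` of the finite normal subgroups `H` of `G`. -/
def FiniteCoset (G : Type u) [Group G] : Type u :=
  {S : Set G // ∃ H : Subgroup G, H.Normal ∧ Finite H ∧ ∃ g : G, S = g • (H : Set G)}

/-- The finite cosets carry the discrete `σ`-algebra. -/
instance instMeasurableSpaceFiniteCoset (G : Type u) [Group G] : MeasurableSpace (FiniteCoset G) :=
  ⊤

/-- `G / N`, as a set of finite cosets (for `N` finite and normal). -/
def cosetsOf {G : Type u} [Group G] (N : Subgroup G) : Set (FiniteCoset G) :=
  {S | ∃ g : G, S.1 = g • (N : Set G)}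

/-- `(X, Y)` follows an erasure distribution: given `Y`, `X` is uniform on the finite coset `Y`. -/
def IsErasure {G : Type u} [Group G] [MeasurableSpace G] [StandardBorelSpace G]
    {Ω : Type v} [MeasurableSpace Ω] (X : Ω → G) (Y : Ω → FiniteCoset G)
    (μ : Measure Ω) [IsFiniteMeasure μ] : Prop :=
  ∀ B : Set G, MeasurableSet B →
    ∀ᵐ ω ∂μ, (condDistrib X Y μ (Y ω)).real B = ((B ∩ (Y ω).1).ncard : ℝ) / ((Y ω).1.ncard : ℝ)

/-- A (possibly non-stationary) source with side information: the pairs `(X i, Y i)` are mutually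
independent and each follows an erasure distribution. Sequences are indexed from `0`, so `X i` is
the `(i + 1)`-st source symbol; the same shift applies to `polarTransform` below. -/
structure IsErasureSource {G : Type u} [Group G] [MeasurableSpace G] [StandardBorelSpace G]
    {Ω : Type v} [MeasurableSpace Ω] (X : ℕ → Ω → G) (Y : ℕ → Ω → FiniteCoset G)
    (μ : Measure Ω) [IsFiniteMeasure μ] : Prop where
  measurable_fst : ∀ i, Measurable (X i)
  measurable_snd : ∀ i, Measurable (Y i)
  indep : iIndepFun (fun i ω => (X i ω, Y i ω)) μ
  erasure : ∀ i, IsErasure (X i) (Y i) μ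

/-- `Q N` is the limiting average probability that the side information is a coset of `N`, for each
finite normal subgroup `N`. -/
def HasCosetFrequencies {G : Type u} [Group G] {Ω : Type v} [MeasurableSpace Ω]
    (Y : ℕ → Ω → FiniteCoset G) (μ : Measure Ω) (Q : Subgroup G → ℝ) : Prop :=
  ∀ N : Subgroup G, N.Normal → Finite N →
    Tendsto (fun m : ℕ => (1 / (m : ℝ)) * ∑ i ∈ Finset.range m, μ.real {ω | Y i ω ∈ cosetsOf N})
      atTop (𝓝 (Q N))

/-- The upper entropy rate `limsup (1 / m) ∑_{i < m} H(X i | Y i)`. -/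
noncomputable def upperEntropyRate {G : Type u} [Group G] [MeasurableSpace G] [StandardBorelSpace G]
    {Ω : Type v} [MeasurableSpace Ω] (X : ℕ → Ω → G) (Y : ℕ → Ω → FiniteCoset G)
    (μ : Measure Ω) [IsFiniteMeasure μ] : ℝ≥0∞ :=
  limsup (fun m : ℕ => (∑ i ∈ Finset.range m, condEntropy (X i) (Y i) μ) / (m : ℝ≥0∞)) atTop

/-- The recursive polar transform `U_n^{(i)}`. At stage `n + 1` the indices are cut into blocks of
length `2 ^ (n + 1)`, and in the block starting at `b` the entries `b + j` and `b + j + 2 ^ n` of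
stage `n` (with `j < 2 ^ n`) produce the entries `b + 2 j` (their product) and `b + 2 j + 1` (the
second of them) of stage `n + 1`. -/
def polarTransform {G : Type u} [Group G] {Ω : Type v} (X : ℕ → Ω → G) : ℕ → ℕ → Ω → G
  | 0, i => X i
  | n + 1, i =>
    let b := 2 ^ (n + 1) * (i / 2 ^ (n + 1))
    let j := (i % 2 ^ (n + 1)) / 2
    if i % 2 = 0 then
      fun ω => polarTransform X n (b + j) ω * polarTransform X n (b + j + 2 ^ n) ω
    else
      polarTransform X n (b + j + 2 ^ n)

/-- The side information of the `i`-th polarized symbol: the earlier polarized symbols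
`U_n^{(j)}`, `j < i`, and all of `Y`. -/
def polarSideInfo {G : Type u} [Group G] {Ω : Type v} (X : ℕ → Ω → G) (Y : ℕ → Ω → FiniteCoset G)
    (n i : ℕ) (ω : Ω) : (Fin i → G) × (ℕ → FiniteCoset G) :=
  (fun j => polarTransform X n j ω, fun j => Y j ω)

/-- `H_n^{(i)} = H(U_n^{(i)} | U_n^{(j)} for j < i, Y)`. -/
noncomputable def polarEntropy {G : Type u} [Group G] [MeasurableSpace G] [StandardBorelSpace G]
    {Ω : Type v} [MeasurableSpace Ω] (X : ℕ → Ω → G) (Y : ℕ → Ω → FiniteCoset G)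
    (μ : Measure Ω) [IsFiniteMeasure μ] (n i : ℕ) : ℝ≥0∞ :=
  condEntropy (polarTransform X n i) (polarSideInfo X Y n i) μ

/-- With this, the quotients of a countable discrete group are found to be standard Borel. -/
instance instCountableQuotientSubgroup {G : Type u} [Group G] [Countable G] (N : Subgroup G) :
    Countable (G ⧸ N) :=
  QuotientGroup.mk_surjective.countable

/-- `H_n^{(i)}[N] = H(U_n^{(i)} N | U_n^{(j)} for j < i, Y)`, where `U_n^{(i)} N` is the coset of
`U_n^{(i)}` in `G / N`. -/
noncomputable def polarCosetEntropy {G : Type u} [Group G] [MeasurableSpace G]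
    (N : Subgroup G) [StandardBorelSpace (G ⧸ N)]
    {Ω : Type v} [MeasurableSpace Ω] (X : ℕ → Ω → G) (Y : ℕ → Ω → FiniteCoset G)
    (μ : Measure Ω) [IsFiniteMeasure μ] (n i : ℕ) : ℝ≥0∞ :=
  condEntropy (fun ω => (QuotientGroup.mk (polarTransform X n i ω) : G ⧸ N)) (polarSideInfo X Y n i) μ

open Classical in
/-- The fraction of the indices `i` among the first `m * 2 ^ n` ones for which
`H_n^{(i)}[N] < δ` and `|H_n^{(i)} - log |N|| < δ`. -/
noncomputable def polarizedFraction {G : Type u} [Group G] [MeasurableSpace G]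
    [StandardBorelSpace G] (N : Subgroup G) [StandardBorelSpace (G ⧸ N)]
    {Ω : Type v} [MeasurableSpace Ω] (X : ℕ → Ω → G) (Y : ℕ → Ω → FiniteCoset G)
    (μ : Measure Ω) [IsFiniteMeasure μ] (δ : ℝ) (n m : ℕ) : ℝ :=
  (1 / ((m : ℝ) * 2 ^ n)) *
    (((Finset.range (m * 2 ^ n)).filter fun i =>
      polarCosetEntropy N X Y μ n i < ENNReal.ofReal δ ∧
        polarEntropy X Y μ n i ≠ ∞ ∧
        |(polarEntropy X Y μ n i).toReal - Real.log (Nat.card N)| < δ).card : ℝ)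

/-!
The proof reduces polarization over the Prüfer group to the evolution of integer-valued levels.

*Reduction to levels.* For each `k` the group has exactly one subgroup `N_k` of order `p ^ k`, and
these subgroups form a chain. So `Y i` is a coset of `N_l` for a random level `l`, and if `X`, `X'`
are uniform on cosets of `N_l`, `N_m`, then `X * X'` is uniform on a coset of `N_(max l m)`, while
`X'` given `X * X'` is uniform on a coset of `N_(min l m)`. Iterating, `U_n^(i)` given its side
information is uniform on a coset of `N_L`, where `L` arises from the source levels by the polar
recursion with `max` and `min` (`IsErasureSource.ae_isUniformOnCoset_polar`). Rather than carrying
conditional laws through the recursion, this is obtained from two facts about the transform of a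
product of subgroups: every element of `N_L` is the `i`-th entry of an allowed translation vector
whose earlier entries vanish (`exists_polarVec_eq`), which makes the conditional law invariant under
`N_L`, and conversely such entries lie in `N_L` (`polarVec_mem`), which puts the law on one coset.
Hence `H_n^(i) = log p * E L` and `H_n^(i)[N_k] = log p * E (L - k)⁺`, and, the levels combined in a
step being independent, the tails `P(L > k)` obey the recursion of binary erasure channels,
`a + b - a b` and `a b`, for all `k` at once.

*Polarization of the levels.* The source need not be stationary and the levels have only bounded
average means, so neither the usual martingale argument along one index nor an `L²` bound applies.
Fix `m` and `n`, let `T = m 2 ^ n`, and for `l ≤ n`, `u < 2 ^ l` let `M_l(u)` be the average of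
`E (L - k)⁺` over the stage-`l` indices below `T` congruent to `u` modulo `2 ^ l`. Then
`M_(l+1)(2 u)` and `M_(l+1)(2 u + 1)` are `M_l(u) ± d`, where `2 d` is the average over the combined
pairs of the mean absolute difference of the two truncated levels. The average of `1 / (1 + M)`
lies in `[0, 1]` and grows by at least the average of `d² / (1 + M)³` in each step, so most
increments `d` are small. The gap of a pair in turn bounds the potential
`min(E (L - k)⁺, 1) - P(L > k)²` of each of its members, and the average of this potential decreases
in `n`; so it tends to `0`, uniformly in `m` (`average_tailPotential_bound`).

*Counting.* If the potentials for all truncations up to `k` are small at an index, then `L` is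
nearly certainly below, equal to or above `k`, and only in the middle case is the index counted by
`polarizedFraction`; hence the indicator differs from `P(L = k)` by at most a multiple of these
potentials (`abs_indicator_sub_levelMass_le`). The average of `P(L = k)` is conserved by the
recursion, and its limit is `Q(N_k)`.

The source with all levels is an independent sequence of uniform elements of `N_k`, with `k`
geometrically distributed.
-/

/-! ### The polar recursion over an arbitrary pair of operations -/

/-- The polar recursion with `f` producing the even-indexed and `g` the odd-indexed entries. The
polar transform is the case `f = (· * ·)`, `g _ b = b`; subgroup levels evolve with `f = max`,
`g = min`, erasure probabilities with `f a b = a + b - a * b`, `g = (· * ·)`. -/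
def polarRec {A : Type*} (f g : A → A → A) (x : ℕ → A) : ℕ → ℕ → A
  | 0, i => x i
  | n + 1, i =>
    let b := 2 ^ (n + 1) * (i / 2 ^ (n + 1))
    let j := (i % 2 ^ (n + 1)) / 2
    if i % 2 = 0 then
      f (polarRec f g x n (b + j)) (polarRec f g x n (b + j + 2 ^ n))
    else
      g (polarRec f g x n (b + j)) (polarRec f g x n (b + j + 2 ^ n))

section polarRec

variable {A B : Type*} {f g : A → A → A} {x y : ℕ → A}

lemma polarRec_zero (i : ℕ) : polarRec f g x 0 i = x i := rfl

lemma polarRec_even (n c : ℕ) {j : ℕ} (hj : j < 2 ^ n) :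
    polarRec f g x (n + 1) (2 ^ (n + 1) * c + 2 * j) =
      f (polarRec f g x n (2 ^ (n + 1) * c + j))
        (polarRec f g x n (2 ^ (n + 1) * c + j + 2 ^ n)) := by
  have h2 : 2 ^ (n + 1) = 2 * 2 ^ n := by ring
  have hlt : 2 * j < 2 ^ (n + 1) := by omega
  have h1 : (2 ^ (n + 1) * c + 2 * j) / 2 ^ (n + 1) = c := by
    rw [Nat.mul_add_div (by positivity), Nat.div_eq_of_lt hlt, add_zero]
  have h3 : (2 ^ (n + 1) * c + 2 * j) % 2 ^ (n + 1) = 2 * j := by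
    rw [Nat.mul_add_mod, Nat.mod_eq_of_lt hlt]
  have h4 : (2 ^ (n + 1) * c + 2 * j) % 2 = 0 := by
    rw [h2, mul_assoc]; omega
  rw [polarRec]
  simp only [h1, h3, h4, if_true]
  rw [Nat.mul_div_cancel_left _ two_pos]

lemma polarRec_odd (n c : ℕ) {j : ℕ} (hj : j < 2 ^ n) :
    polarRec f g x (n + 1) (2 ^ (n + 1) * c + (2 * j + 1)) =
      g (polarRec f g x n (2 ^ (n + 1) * c + j))
        (polarRec f g x n (2 ^ (n + 1) * c + j + 2 ^ n)) := by
  have h2 : 2 ^ (n + 1) = 2 * 2 ^ n := by ring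
  have hlt : 2 * j + 1 < 2 ^ (n + 1) := by omega
  have h1 : (2 ^ (n + 1) * c + (2 * j + 1)) / 2 ^ (n + 1) = c := by
    rw [Nat.mul_add_div (by positivity), Nat.div_eq_of_lt hlt, add_zero]
  have h3 : (2 ^ (n + 1) * c + (2 * j + 1)) % 2 ^ (n + 1) = 2 * j + 1 := by
    rw [Nat.mul_add_mod, Nat.mod_eq_of_lt hlt]
  have h4 : (2 ^ (n + 1) * c + (2 * j + 1)) % 2 = 1 := by
    rw [h2, mul_assoc]; omega
  rw [polarRec]
  simp only [h1, h3, h4]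
  rw [show (2 * j + 1) / 2 = j by omega]
  simp

/-- Every index of stage `n + 1` is an even or an odd entry of one of the blocks. -/
lemma exists_even_or_odd (n i : ℕ) :
    ∃ c j, j < 2 ^ n ∧ (i = 2 ^ (n + 1) * c + 2 * j ∨ i = 2 ^ (n + 1) * c + (2 * j + 1)) := by
  refine ⟨i / 2 ^ (n + 1), (i % 2 ^ (n + 1)) / 2, ?_, ?_⟩
  · have := Nat.mod_lt i (show 0 < 2 ^ (n + 1) by positivity)
    rw [pow_succ] at this ⊢
    omega
  · have := Nat.div_add_mod i (2 ^ (n + 1))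
    omega

lemma polarRec_induction {P : A → Prop} (hf : ∀ a b, P a → P b → P (f a b))
    (hg : ∀ a b, P a → P b → P (g a b)) (hx : ∀ i, P (x i)) (n i : ℕ) :
    P (polarRec f g x n i) := by
  induction n generalizing i with
  | zero => exact hx i
  | succ n ih =>
    obtain ⟨c, j, hj, rfl | rfl⟩ := exists_even_or_odd n i
    · rw [polarRec_even n c hj]; exact hf _ _ (ih _) (ih _)
    · rw [polarRec_odd n c hj]; exact hg _ _ (ih _) (ih _)

lemma polarRec_map {f' g' : B → B → B} (φ : A → B)
    (hf : ∀ a b, φ (f a b) = f' (φ a) (φ b)) (hg : ∀ a b, φ (g a b) = g' (φ a) (φ b)) (n i : ℕ) :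
    φ (polarRec f g x n i) = polarRec f' g' (fun i => φ (x i)) n i := by
  induction n generalizing i with
  | zero => rfl
  | succ n ih =>
    obtain ⟨c, j, hj, rfl | rfl⟩ := exists_even_or_odd n i
    · rw [polarRec_even n c hj, polarRec_even n c hj, hf, ih, ih]
    · rw [polarRec_odd n c hj, polarRec_odd n c hj, hg, ih, ih]

/-- The entries of a block depend only on the source symbols of that block. -/
lemma polarRec_congr {n c r : ℕ} (hr : r < 2 ^ n)
    (h : ∀ s < 2 ^ n, x (2 ^ n * c + s) = y (2 ^ n * c + s)) :
    polarRec f g x n (2 ^ n * c + r) = polarRec f g y n (2 ^ n * c + r) := by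
  induction n generalizing c r with
  | zero => simpa [polarRec] using h r hr
  | succ n ih =>
    have h2 : 2 ^ (n + 1) = 2 * 2 ^ n := by ring
    have key : ∀ j < 2 ^ n,
        polarRec f g x n (2 ^ (n + 1) * c + j) = polarRec f g y n (2 ^ (n + 1) * c + j) ∧
        polarRec f g x n (2 ^ (n + 1) * c + j + 2 ^ n) =
          polarRec f g y n (2 ^ (n + 1) * c + j + 2 ^ n) := by
      intro j hj
      constructor
      · have := ih (c := 2 * c) (r := j) hj (fun s hs => by
          have := h s (by omega); rwa [h2, mul_comm 2, mul_assoc] at this)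
        rwa [← mul_assoc, mul_comm _ 2, ← h2] at this
      · have := ih (c := 2 * c + 1) (r := j) hj (fun s hs => by
          have := h (2 ^ n + s) (by omega)
          convert this using 2 <;> rw [h2] <;> ring)
        convert this using 2 <;> rw [h2] <;> ring
    obtain ⟨j, hj, rfl | rfl⟩ : ∃ j < 2 ^ n, r = 2 * j ∨ r = 2 * j + 1 :=
      ⟨r / 2, by omega, by omega⟩
    · rw [polarRec_even n c hj, polarRec_even n c hj, (key j hj).1, (key j hj).2]
    · rw [polarRec_odd n c hj, polarRec_odd n c hj, (key j hj).1, (key j hj).2]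

lemma polarRec_shift (hx : ∀ i j, x i = x j) (n c r : ℕ) (hr : r < 2 ^ n) :
    polarRec f g x n (2 ^ n * c + r) = polarRec f g x n r := by
  induction n generalizing c r with
  | zero => exact hx _ _
  | succ n ih =>
    have h2 : 2 ^ (n + 1) = 2 * 2 ^ n := by ring
    have key : ∀ c, ∀ j < 2 ^ n,
        polarRec f g x n (2 ^ (n + 1) * c + j) = polarRec f g x n j ∧
        polarRec f g x n (2 ^ (n + 1) * c + j + 2 ^ n) = polarRec f g x n j := by
      intro c j hj
      constructor
      · rw [← ih (2 * c) j hj]; congr 1; rw [h2]; ring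
      · rw [← ih (2 * c + 1) j hj]; congr 1; rw [h2]; ring
    obtain ⟨j, hj, rfl | rfl⟩ : ∃ j < 2 ^ n, r = 2 * j ∨ r = 2 * j + 1 :=
      ⟨r / 2, by omega, by omega⟩
    · have := polarRec_even (f := f) (g := g) (x := x) n 0 hj
      rw [mul_zero, zero_add, zero_add] at this
      have h0 := key 0 j hj
      rw [mul_zero, zero_add] at h0
      rw [polarRec_even n c hj, this, (key c j hj).1, (key c j hj).2, h0.2]
    · have := polarRec_odd (f := f) (g := g) (x := x) n 0 hj
      rw [mul_zero, zero_add, zero_add] at this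
      have h0 := key 0 j hj
      rw [mul_zero, zero_add] at h0
      rw [polarRec_odd n c hj, this, (key c j hj).1, (key c j hj).2, h0.2]

lemma sum_range_mul_eq {M : Type*} [AddCommMonoid M] (m q : ℕ) (F : ℕ → M) :
    ∑ i ∈ Finset.range (m * q), F i =
      ∑ c ∈ Finset.range m, ∑ r ∈ Finset.range q, F (q * c + r) := by
  induction m with
  | zero => simp
  | succ m ih =>
    rw [add_mul, one_mul, Finset.sum_range_add, ih, Finset.sum_range_succ, mul_comm m q]

lemma sum_range_two_mul {M : Type*} [AddCommMonoid M] (q : ℕ) (F : ℕ → M) :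
    ∑ r ∈ Finset.range (2 * q), F r = ∑ j ∈ Finset.range q, (F (2 * j) + F (2 * j + 1)) := by
  rw [mul_comm, sum_range_mul_eq]
  simp [Finset.sum_range_succ]

/-- The sum of a function of the entries of stage `n`, arranged by the pairs that are combined
at the next step. -/
lemma sum_polarRec_pair {M : Type*} [AddCommMonoid M] (F : A → M) (m n : ℕ) :
    ∑ i ∈ Finset.range (m * 2 ^ (n + 1)), F (polarRec f g x n i) =
      ∑ c ∈ Finset.range m, ∑ j ∈ Finset.range (2 ^ n),
        (F (polarRec f g x n (2 ^ (n + 1) * c + j)) +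
          F (polarRec f g x n (2 ^ (n + 1) * c + j + 2 ^ n))) := by
  rw [sum_range_mul_eq]
  refine Finset.sum_congr rfl fun c _ => ?_
  rw [show 2 ^ (n + 1) = 2 ^ n + 2 ^ n by ring, Finset.sum_range_add, Finset.sum_add_distrib]
  congr 1
  refine Finset.sum_congr rfl fun j _ => ?_
  rw [add_right_comm, add_assoc (_ * c)]

lemma sum_polarRec_succ {M : Type*} [AddCommMonoid M] (F : A → M) (m n : ℕ) :
    ∑ i ∈ Finset.range (m * 2 ^ (n + 1)), F (polarRec f g x (n + 1) i) =
      ∑ c ∈ Finset.range m, ∑ j ∈ Finset.range (2 ^ n),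
        (F (f (polarRec f g x n (2 ^ (n + 1) * c + j))
            (polarRec f g x n (2 ^ (n + 1) * c + j + 2 ^ n))) +
          F (g (polarRec f g x n (2 ^ (n + 1) * c + j))
            (polarRec f g x n (2 ^ (n + 1) * c + j + 2 ^ n)))) := by
  rw [sum_range_mul_eq]
  refine Finset.sum_congr rfl fun c _ => ?_
  rw [show Finset.range (2 ^ (n + 1)) = Finset.range (2 * 2 ^ n) by rw [pow_succ, mul_comm],
    sum_range_two_mul]
  refine Finset.sum_congr rfl fun j hj => ?_
  rw [Finset.mem_range] at hj
  rw [polarRec_even n c hj, polarRec_odd n c hj]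

/-- A function that decreases under every combination of a pair decreases on average. -/
lemma sum_polarRec_antitone {P : A → Prop} (hf : ∀ a b, P a → P b → P (f a b))
    (hg : ∀ a b, P a → P b → P (g a b)) (hx : ∀ i, P (x i)) (F : A → ℝ)
    (hF : ∀ a b, P a → P b → F (f a b) + F (g a b) ≤ F a + F b) (m l n : ℕ) :
    ∑ i ∈ Finset.range (m * 2 ^ (l + n)), F (polarRec f g x (l + n) i) ≤
      ∑ i ∈ Finset.range (m * 2 ^ (l + n)), F (polarRec f g x l i) := by
  induction n generalizing m with
  | zero => exact le_rfl
  | succ n ih =>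
    have h1 : ∑ i ∈ Finset.range (m * 2 ^ (l + n + 1)), F (polarRec f g x (l + n + 1) i) ≤
        ∑ i ∈ Finset.range (m * 2 ^ (l + n + 1)), F (polarRec f g x (l + n) i) := by
      rw [sum_polarRec_succ, sum_polarRec_pair]
      exact Finset.sum_le_sum fun c _ => Finset.sum_le_sum fun j _ =>
        hF _ _ (polarRec_induction hf hg hx _ _) (polarRec_induction hf hg hx _ _)
    have h2 := ih (m * 2)
    rw [mul_assoc, ← pow_succ'] at h2
    exact h1.trans h2

lemma sum_polarRec_eq {P : A → Prop} (hf : ∀ a b, P a → P b → P (f a b))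
    (hg : ∀ a b, P a → P b → P (g a b)) (hx : ∀ i, P (x i)) (F : A → ℝ)
    (hF : ∀ a b, P a → P b → F (f a b) + F (g a b) = F a + F b) (m l n : ℕ) :
    ∑ i ∈ Finset.range (m * 2 ^ (l + n)), F (polarRec f g x (l + n) i) =
      ∑ i ∈ Finset.range (m * 2 ^ (l + n)), F (polarRec f g x l i) := by
  refine le_antisymm (sum_polarRec_antitone hf hg hx F (fun a b ha hb => (hF a b ha hb).le) _ _ _)
    ?_
  have := sum_polarRec_antitone hf hg hx (fun a => - F a)
    (fun a b ha hb => by have := hF a b ha hb; linarith) m l n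
  simpa using this

end polarRec

/-! ### Polarization of tail sequences -/

/-- A sequence of the form `k ↦ P(L > k)` with `L` a natural number of finite mean. -/
structure IsTail (a : ℕ → ℝ) : Prop where
  anti : Antitone a
  nonneg : ∀ k, 0 ≤ a k
  le_one : ∀ k, a k ≤ 1
  summable : Summable a

/-- The tail of the maximum of independent variables with tails `a` and `b`. -/
def maxTail (a b : ℕ → ℝ) : ℕ → ℝ := fun k => a k + b k - a k * b k

/-- The tail of the minimum of independent variables with tails `a` and `b`. -/
def minTail (a b : ℕ → ℝ) : ℕ → ℝ := fun k => a k * b k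

/-- The mean difference `E|L - L'| = E max(L, L') - E min(L, L')` of independent variables with
tails `a` and `b`. -/
noncomputable def tailGap (a b : ℕ → ℝ) : ℝ := ∑' k, (a k + b k - 2 * (a k * b k))

/-- The potential `min(E L, 1) - P(L > 0)²`. It is small only if `L` is nearly certain to vanish
and has small mean, or nearly certain to be positive. -/
noncomputable def tailPotential (a : ℕ → ℝ) : ℝ := min (∑' k, a k) 1 - a 0 ^ 2

namespace IsTail

variable {a b : ℕ → ℝ}

lemma summable_mul (ha : IsTail a) (hb : IsTail b) : Summable fun k => a k * b k :=
  Summable.of_nonneg_of_le (fun k => mul_nonneg (ha.nonneg k) (hb.nonneg k))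
    (fun k => mul_le_of_le_one_right (ha.nonneg k) (hb.le_one k)) ha.summable

lemma minTail (ha : IsTail a) (hb : IsTail b) : IsTail (minTail a b) where
  anti _ _ h := mul_le_mul (ha.anti h) (hb.anti h) (hb.nonneg _) (ha.nonneg _)
  nonneg k := mul_nonneg (ha.nonneg k) (hb.nonneg k)
  le_one k := mul_le_one₀ (ha.le_one k) (hb.nonneg k) (hb.le_one k)
  summable := ha.summable_mul hb

lemma maxTail (ha : IsTail a) (hb : IsTail b) : IsTail (maxTail a b) where
  anti i j h := by
    have h1 := ha.anti h
    have h2 := hb.anti h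
    have := ha.le_one j; have := hb.le_one i
    unfold _root_.maxTail
    nlinarith
  nonneg k := by
    have := ha.nonneg k; have := hb.nonneg k; have := hb.le_one k
    unfold _root_.maxTail
    nlinarith
  le_one k := by
    have := ha.le_one k; have := hb.le_one k
    unfold _root_.maxTail
    nlinarith
  summable := (ha.summable.add hb.summable).sub (ha.summable_mul hb)

lemma tsum_nonneg (ha : IsTail a) : 0 ≤ ∑' k, a k := _root_.tsum_nonneg ha.nonneg

lemma zero_le_tsum (ha : IsTail a) : a 0 ≤ ∑' k, a k :=
  ha.summable.le_tsum 0 fun k _ => ha.nonneg k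

lemma tsum_maxTail_add (ha : IsTail a) (hb : IsTail b) :
    ∑' k, _root_.maxTail a b k + ∑' k, _root_.minTail a b k = ∑' k, a k + ∑' k, b k := by
  rw [← (ha.maxTail hb).summable.tsum_add (ha.minTail hb).summable,
    ← ha.summable.tsum_add hb.summable]
  congr 1; ext k; simp [_root_.maxTail, _root_.minTail]

lemma tsum_maxTail_sub (ha : IsTail a) (hb : IsTail b) :
    ∑' k, _root_.maxTail a b k - ∑' k, _root_.minTail a b k = tailGap a b := by
  rw [← (ha.maxTail hb).summable.tsum_sub (ha.minTail hb).summable, tailGap]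
  congr 1; ext k; simp only [_root_.maxTail, _root_.minTail]; ring

lemma gap_nonneg (ha : IsTail a) (hb : IsTail b) (k : ℕ) : 0 ≤ a k + b k - 2 * (a k * b k) := by
  have := ha.nonneg k; have := hb.nonneg k; have := ha.le_one k; have := hb.le_one k
  nlinarith

lemma summable_gap (ha : IsTail a) (hb : IsTail b) :
    Summable fun k => a k + b k - 2 * (a k * b k) :=
  (ha.summable.add hb.summable).sub ((ha.summable_mul hb).mul_left 2)

lemma tailGap_nonneg (ha : IsTail a) (hb : IsTail b) : 0 ≤ tailGap a b :=
  _root_.tsum_nonneg (ha.gap_nonneg hb)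

lemma le_tailGap (ha : IsTail a) (hb : IsTail b) :
    a 0 + b 0 - 2 * (a 0 * b 0) ≤ tailGap a b :=
  (ha.summable_gap hb).le_tsum 0 fun k _ => ha.gap_nonneg hb k

lemma tsum_le_maxTail_left (ha : IsTail a) (hb : IsTail b) :
    ∑' k, a k ≤ ∑' k, _root_.maxTail a b k := by
  refine ha.summable.tsum_le_tsum (fun k => ?_) (ha.maxTail hb).summable
  have := hb.nonneg k; have := ha.le_one k
  unfold _root_.maxTail; nlinarith

lemma tsum_le_maxTail_right (ha : IsTail a) (hb : IsTail b) :
    ∑' k, b k ≤ ∑' k, _root_.maxTail a b k := by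
  refine hb.summable.tsum_le_tsum (fun k => ?_) (ha.maxTail hb).summable
  have := ha.nonneg k; have := hb.le_one k
  unfold _root_.maxTail; nlinarith

lemma tailPotential_nonneg (ha : IsTail a) : 0 ≤ tailPotential a := by
  have h1 := ha.zero_le_tsum
  have h2 := ha.nonneg 0
  have h3 := ha.le_one 0
  have h4 : a 0 ≤ min (∑' k, a k) 1 := le_min h1 h3
  unfold tailPotential; nlinarith

lemma tailPotential_le_one (a : ℕ → ℝ) : tailPotential a ≤ 1 := by
  have := min_le_right (∑' k, a k) 1
  unfold tailPotential; nlinarith [sq_nonneg (a 0)]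

lemma tailPotential_add_le (ha : IsTail a) (hb : IsTail b) :
    tailPotential (_root_.maxTail a b) + tailPotential (_root_.minTail a b) ≤
      tailPotential a + tailPotential b := by
  have h1 := ha.tsum_le_maxTail_left hb
  have h2 := ha.tsum_le_maxTail_right hb
  have h3 := ha.tsum_maxTail_add hb
  have hmin : min (∑' k, _root_.maxTail a b k) 1 + min (∑' k, _root_.minTail a b k) 1 ≤
      min (∑' k, a k) 1 + min (∑' k, b k) 1 := by
    simp only [min_def]; split_ifs <;> linarith
  have h4 := ha.nonneg 0; have h5 := hb.nonneg 0; have h6 := ha.le_one 0; have h7 := hb.le_one 0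
  have hsq : a 0 ^ 2 + b 0 ^ 2 ≤ _root_.maxTail a b 0 ^ 2 + _root_.minTail a b 0 ^ 2 := by
    have : 0 ≤ (a 0 * b 0) * ((1 - a 0) * (1 - b 0)) :=
      mul_nonneg (mul_nonneg h4 h5) (mul_nonneg (by linarith) (by linarith))
    unfold _root_.maxTail _root_.minTail
    nlinarith
  unfold tailPotential; linarith

/-- The potential of one member of a pair is controlled by the gap of the pair, whatever the
other member is. -/
lemma tailPotential_le_left (ha : IsTail a) (hb : IsTail b) :
    tailPotential a ≤ 3 * tailGap a b := by
  have h4 := ha.nonneg 0; have h5 := hb.nonneg 0; have h6 := ha.le_one 0; have h7 := hb.le_one 0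
  have hg := ha.le_tailGap hb
  have hvar : a 0 - a 0 ^ 2 ≤ tailGap a b := by nlinarith [sq_nonneg (a 0 - b 0)]
  have hmean : min (∑' k, a k) 1 - a 0 ≤ 2 * tailGap a b := by
    rcases le_or_gt (b 0) (1 / 2) with hb2 | hb2
    · have : ∑' k, a k ≤ ∑' k, 2 * (a k + b k - 2 * (a k * b k)) := by
        refine ha.summable.tsum_le_tsum (fun k => ?_) ((ha.summable_gap hb).mul_left 2)
        have := hb.anti (Nat.zero_le k)
        have := ha.nonneg k; have := hb.nonneg k; have := ha.le_one k
        nlinarith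
      rw [tsum_mul_left] at this
      have := min_le_left (∑' k, a k) 1
      unfold tailGap; linarith
    · have := min_le_right (∑' k, a k) 1
      nlinarith
  unfold tailPotential; linarith

lemma tailPotential_le_right (ha : IsTail a) (hb : IsTail b) :
    tailPotential b ≤ 3 * tailGap a b := by
  have := hb.tailPotential_le_left ha
  rwa [show tailGap b a = tailGap a b by unfold tailGap; congr 1; ext k; ring] at this

lemma shift (ha : IsTail a) (k : ℕ) : IsTail fun j => a (j + k) where
  anti _ _ h := ha.anti (by omega)
  nonneg j := ha.nonneg _
  le_one j := ha.le_one _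
  summable := (summable_nat_add_iff k).2 ha.summable

end IsTail

/-- The polarized tail sequences of independent levels with tails `x i`. -/
noncomputable def polarTail (x : ℕ → ℕ → ℝ) (n i : ℕ) : ℕ → ℝ := polarRec maxTail minTail x n i

section polarTail

variable {x : ℕ → ℕ → ℝ}

lemma isTail_polarTail (hx : ∀ i, IsTail (x i)) (n i : ℕ) : IsTail (polarTail x n i) :=
  polarRec_induction (fun _ _ ha hb => ha.maxTail hb) (fun _ _ ha hb => ha.minTail hb) hx n i

lemma polarTail_even (x : ℕ → ℕ → ℝ) (n c : ℕ) {j : ℕ} (hj : j < 2 ^ n) :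
    polarTail x (n + 1) (2 ^ (n + 1) * c + 2 * j) =
      maxTail (polarTail x n (2 ^ (n + 1) * c + j)) (polarTail x n (2 ^ (n + 1) * c + j + 2 ^ n)) :=
  polarRec_even n c hj

lemma polarTail_odd (x : ℕ → ℕ → ℝ) (n c : ℕ) {j : ℕ} (hj : j < 2 ^ n) :
    polarTail x (n + 1) (2 ^ (n + 1) * c + (2 * j + 1)) =
      minTail (polarTail x n (2 ^ (n + 1) * c + j)) (polarTail x n (2 ^ (n + 1) * c + j + 2 ^ n)) :=
  polarRec_odd n c hj

lemma polarTail_shift (x : ℕ → ℕ → ℝ) (k n i : ℕ) :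
    polarTail (fun i j => x i (j + k)) n i = fun j => polarTail x n i (j + k) :=
  (polarRec_map (f := maxTail) (g := minTail) (f' := maxTail) (g' := minTail)
    (fun a : ℕ → ℝ => fun j => a (j + k)) (fun _ _ => rfl) (fun _ _ => rfl) n i).symm

lemma sum_polarTail_apply (hx : ∀ i, IsTail (x i)) (k m n : ℕ) :
    ∑ i ∈ Finset.range (m * 2 ^ n), polarTail x n i k = ∑ i ∈ Finset.range (m * 2 ^ n), x i k := by
  have := sum_polarRec_eq (f := maxTail) (g := minTail) (P := IsTail)
    (fun _ _ ha hb => ha.maxTail hb) (fun _ _ ha hb => ha.minTail hb) hx (fun a => a k)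
    (fun a b _ _ => by simp [maxTail, minTail]) m 0 n
  simpa [polarTail, polarRec_zero] using this

lemma sum_tailPotential_antitone (hx : ∀ i, IsTail (x i)) (m l n : ℕ) :
    ∑ i ∈ Finset.range (m * 2 ^ (l + n)), tailPotential (polarTail x (l + n) i) ≤
      ∑ i ∈ Finset.range (m * 2 ^ (l + n)), tailPotential (polarTail x l i) :=
  sum_polarRec_antitone (P := IsTail) (fun _ _ ha hb => ha.maxTail hb)
    (fun _ _ ha hb => ha.minTail hb) hx tailPotential
    (fun _ _ ha hb => ha.tailPotential_add_le hb) m l n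

/-- The average of the means over the entries of stage `l` at position `u` in the first `A` blocks
of length `2 ^ l`. With `A * 2 ^ l` fixed, this is a martingale in `l` when the next bit of `u` is
chosen by a fair coin. -/
noncomputable def positionMean (x : ℕ → ℕ → ℝ) (A l u : ℕ) : ℝ :=
  (1 / (A : ℝ)) * ∑ c ∈ Finset.range A, ∑' k, polarTail x l (2 ^ l * c + u) k

lemma positionMean_nonneg (hx : ∀ i, IsTail (x i)) (A l u : ℕ) : 0 ≤ positionMean x A l u :=
  mul_nonneg (by positivity) (Finset.sum_nonneg fun _ _ => (isTail_polarTail hx _ _).tsum_nonneg)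

/-- Half the mean gap of the pairs combined at step `l + 1` at position `u`: the size of the
martingale increment of `positionMean`. -/
noncomputable def positionGap (x : ℕ → ℕ → ℝ) (A l u : ℕ) : ℝ :=
  (1 / (2 * (A : ℝ))) * ∑ c ∈ Finset.range A,
    tailGap (polarTail x l (2 ^ (l + 1) * c + u)) (polarTail x l (2 ^ (l + 1) * c + u + 2 ^ l))

lemma positionGap_nonneg (hx : ∀ i, IsTail (x i)) (A l u : ℕ) : 0 ≤ positionGap x A l u :=
  mul_nonneg (by positivity) (Finset.sum_nonneg fun _ _ =>
    (isTail_polarTail hx _ _).tailGap_nonneg (isTail_polarTail hx _ _))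

lemma positionMean_two_mul (x : ℕ → ℕ → ℝ) (A l u : ℕ) :
    positionMean x (A * 2) l u = (1 / (2 * (A : ℝ))) * ∑ c ∈ Finset.range A,
      (∑' k, polarTail x l (2 ^ (l + 1) * c + u) k +
        ∑' k, polarTail x l (2 ^ (l + 1) * c + u + 2 ^ l) k) := by
  unfold positionMean
  rw [sum_range_mul_eq]
  push_cast
  rw [mul_comm (A : ℝ) 2]
  congr 1
  refine Finset.sum_congr rfl fun c _ => ?_
  rw [Finset.sum_range_succ, Finset.sum_range_one]
  rw [show 2 ^ l * (2 * c + 0) + u = 2 ^ (l + 1) * c + u by ring,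
    show 2 ^ l * (2 * c + 1) + u = 2 ^ (l + 1) * c + u + 2 ^ l by ring]

lemma positionMean_succ (hx : ∀ i, IsTail (x i)) (A l : ℕ) {u : ℕ} (hu : u < 2 ^ l) :
    positionMean x A (l + 1) (2 * u) = positionMean x (A * 2) l u + positionGap x A l u ∧
    positionMean x A (l + 1) (2 * u + 1) = positionMean x (A * 2) l u - positionGap x A l u := by
  rw [positionMean_two_mul, positionGap, ← mul_add, ← mul_sub, ← Finset.sum_add_distrib,
    ← Finset.sum_sub_distrib]
  unfold positionMean
  rw [show (1 / (2 * (A : ℝ))) = 1 / A * (1 / 2) by rw [one_div_mul_one_div, mul_comm]]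
  constructor <;> rw [mul_assoc (1 / (A : ℝ)), Finset.mul_sum _ _ (1 / 2 : ℝ)] <;> congr 1 <;>
    refine Finset.sum_congr rfl fun c _ => ?_
  all_goals
    have ha := isTail_polarTail hx l (2 ^ (l + 1) * c + u)
    have hb := isTail_polarTail hx l (2 ^ (l + 1) * c + u + 2 ^ l)
    have h1 := ha.tsum_maxTail_add hb
    have h2 := ha.tsum_maxTail_sub hb
  · rw [polarTail_even x l c hu]; linarith
  · rw [polarTail_odd x l c hu]; linarith

/-- The convex potential `1 / (1 + M)` increases, on average, by at least `d² / (1 + M)³` when `M`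
is replaced by `M ± d`. -/
lemma inv_one_add_gain {M d : ℝ} (h0 : 0 ≤ M) (hd : 0 ≤ d) (hM : 0 ≤ M - d) :
    d ^ 2 / (1 + M) ^ 3 ≤ (1 / (1 + (M + d)) + 1 / (1 + (M - d))) / 2 - 1 / (1 + M) := by
  have hp : 0 < 1 + M := by linarith
  have h1 : 0 < 1 + (M + d) := by linarith
  have h2 : 0 < 1 + (M - d) := by linarith
  have key : (1 / (1 + (M + d)) + 1 / (1 + (M - d))) / 2 - 1 / (1 + M) =
      d ^ 2 / ((1 + M) * ((1 + (M + d)) * (1 + (M - d)))) := by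
    field_simp; ring
  rw [key]
  apply div_le_div_of_nonneg_left (by positivity) (by positivity)
  nlinarith [mul_nonneg hp.le (sq_nonneg d)]

/-- A linear bound for `min (6 d) 1`, used with `K` large, then `α` small. -/
lemma min_le_of_gain {M d K α : ℝ} (h0 : 0 ≤ M) (hK : 0 < K) (hα : 0 < α) :
    min (6 * d) 1 ≤ M / K + 6 * α + 3 / 2 * (1 + K) ^ 3 / α * (d ^ 2 / (1 + M) ^ 3) := by
  have hnn : 0 ≤ 3 / 2 * (1 + K) ^ 3 / α * (d ^ 2 / (1 + M) ^ 3) := by positivity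
  rcases le_or_gt K M with h | h
  · have : 1 ≤ M / K := by rwa [le_div_iff₀ hK, one_mul]
    have := min_le_right (6 * d) 1
    linarith
  · have h1 : d ^ 2 ≤ (1 + K) ^ 3 * (d ^ 2 / (1 + M) ^ 3) := by
      rw [mul_div_assoc', le_div_iff₀ (by positivity), mul_comm]
      gcongr
    have h2 : 6 * d ≤ 6 * α + 3 / 2 * d ^ 2 / α := by
      rw [← sub_le_iff_le_add', le_div_iff₀ hα]
      nlinarith [sq_nonneg (d - 2 * α)]
    have h3 : 3 / 2 * d ^ 2 / α ≤ 3 / 2 * (1 + K) ^ 3 / α * (d ^ 2 / (1 + M) ^ 3) := by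
      calc 3 / 2 * d ^ 2 / α ≤ 3 / 2 * ((1 + K) ^ 3 * (d ^ 2 / (1 + M) ^ 3)) / α := by gcongr
        _ = _ := by ring
    have := min_le_left (6 * d) 1
    have : 0 ≤ M / K := by positivity
    linarith

/-- The average over positions of `1 / (1 + positionMean)`. -/
noncomputable def meanPotential (x : ℕ → ℕ → ℝ) (A l : ℕ) : ℝ :=
  (1 / 2 ^ l) * ∑ u ∈ Finset.range (2 ^ l), 1 / (1 + positionMean x A l u)

lemma meanPotential_nonneg (hx : ∀ i, IsTail (x i)) (A l : ℕ) : 0 ≤ meanPotential x A l :=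
  mul_nonneg (by positivity) (Finset.sum_nonneg fun u _ => by
    have := positionMean_nonneg hx A l u; positivity)

lemma meanPotential_le_one (hx : ∀ i, IsTail (x i)) (A l : ℕ) : meanPotential x A l ≤ 1 := by
  have : ∑ u ∈ Finset.range (2 ^ l), 1 / (1 + positionMean x A l u) ≤
      ∑ u ∈ Finset.range (2 ^ l), (1 : ℝ) := by
    refine Finset.sum_le_sum fun u _ => ?_
    have := positionMean_nonneg hx A l u
    rw [div_le_one (by positivity)]; linarith
  unfold meanPotential
  rw [one_div, inv_mul_le_iff₀ (by positivity)]
  simpa using this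

lemma meanPotential_gain (hx : ∀ i, IsTail (x i)) (A l : ℕ) :
    (1 / 2 ^ l) * ∑ u ∈ Finset.range (2 ^ l),
        positionGap x A l u ^ 2 / (1 + positionMean x (A * 2) l u) ^ 3 ≤
      meanPotential x A (l + 1) - meanPotential x (A * 2) l := by
  have : meanPotential x A (l + 1) - meanPotential x (A * 2) l =
      (1 / 2 ^ l) * ∑ u ∈ Finset.range (2 ^ l),
        ((1 / (1 + positionMean x A (l + 1) (2 * u)) +
          1 / (1 + positionMean x A (l + 1) (2 * u + 1))) / 2 -
            1 / (1 + positionMean x (A * 2) l u)) := by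
    unfold meanPotential
    rw [show Finset.range (2 ^ (l + 1)) = Finset.range (2 * 2 ^ l) by rw [pow_succ, mul_comm],
      sum_range_two_mul, Finset.sum_sub_distrib, mul_sub, ← Finset.sum_div, pow_succ]
    field_simp
  rw [this]
  refine mul_le_mul_of_nonneg_left (Finset.sum_le_sum fun u hu => ?_) (by positivity)
  obtain ⟨h1, h2⟩ := positionMean_succ hx A l (Finset.mem_range.1 hu)
  rw [h1, h2]
  exact inv_one_add_gain (positionMean_nonneg hx _ _ _) (positionGap_nonneg hx _ _ _)
    (h2 ▸ positionMean_nonneg hx _ _ _)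

/-- The average of the means does not depend on the stage. -/
lemma average_positionMean (hx : ∀ i, IsTail (x i)) (A l : ℕ) :
    (1 / 2 ^ l) * ∑ u ∈ Finset.range (2 ^ l), positionMean x A l u =
      (1 / ((A : ℝ) * 2 ^ l)) * ∑ i ∈ Finset.range (A * 2 ^ l), ∑' k, x i k := by
  have h := sum_polarRec_eq (f := maxTail) (g := minTail) (P := IsTail)
    (fun _ _ ha hb => ha.maxTail hb) (fun _ _ ha hb => ha.minTail hb) hx (fun a => ∑' k, a k)
    (fun a b ha hb => ha.tsum_maxTail_add hb) A 0 l
  simp only [zero_add, polarRec_zero] at h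
  rw [← h, sum_range_mul_eq, Finset.sum_comm]
  unfold positionMean polarTail
  rw [← Finset.mul_sum, ← mul_assoc, one_div_mul_one_div, mul_comm (2 ^ l : ℝ)]

/-- The average potential of stage `l` is controlled by the gaps at step `l + 1`. -/
lemma average_tailPotential_le (hx : ∀ i, IsTail (x i)) {A : ℕ} (hA : 0 < A) (l : ℕ) :
    (1 / ((A * 2 : ℕ) * 2 ^ l : ℝ)) * ∑ i ∈ Finset.range (A * 2 * 2 ^ l),
        tailPotential (polarTail x l i) ≤
      (1 / 2 ^ l) * ∑ u ∈ Finset.range (2 ^ l), min (6 * positionGap x A l u) 1 := by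
  have hA' : (0 : ℝ) < A := by exact_mod_cast hA
  have hpair := sum_polarRec_pair (f := maxTail) (g := minTail) (x := x) tailPotential A l
  change ∑ i ∈ Finset.range (A * 2 ^ (l + 1)), tailPotential (polarTail x l i) = _ at hpair
  rw [mul_assoc A, ← pow_succ', hpair, Finset.sum_comm]
  have : ∀ u ∈ Finset.range (2 ^ l), (1 / (2 * (A : ℝ))) * ∑ c ∈ Finset.range A,
      (tailPotential (polarTail x l (2 ^ (l + 1) * c + u)) +
        tailPotential (polarTail x l (2 ^ (l + 1) * c + u + 2 ^ l))) ≤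
      min (6 * positionGap x A l u) 1 := by
    intro u _
    refine le_min ?_ ?_
    · unfold positionGap
      rw [mul_left_comm]
      refine mul_le_mul_of_nonneg_left ?_ (by positivity)
      rw [Finset.mul_sum]
      refine Finset.sum_le_sum fun c _ => ?_
      have ha := isTail_polarTail hx l (2 ^ (l + 1) * c + u)
      have hb := isTail_polarTail hx l (2 ^ (l + 1) * c + u + 2 ^ l)
      have := ha.tailPotential_le_left hb
      have := ha.tailPotential_le_right hb
      linarith
    · rw [one_div, inv_mul_le_iff₀ (by positivity), mul_one]
      calc _ ≤ ∑ c ∈ Finset.range A, (2 : ℝ) := Finset.sum_le_sum fun c _ => by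
            have := IsTail.tailPotential_le_one (polarTail x l (2 ^ (l + 1) * c + u))
            have := IsTail.tailPotential_le_one (polarTail x l (2 ^ (l + 1) * c + u + 2 ^ l))
            linarith
        _ = 2 * A := by simp [mul_comm]
  refine le_trans (le_of_eq ?_) (mul_le_mul_of_nonneg_left (Finset.sum_le_sum this) (by positivity))
  rw [← Finset.mul_sum, ← mul_assoc]
  congr 1
  push_cast
  field_simp

/-- **Quantitative polarization.** After `n` steps the average potential is small as soon as the
average mean is bounded; the bound holds for every sequence of source tails. -/
theorem average_tailPotential_bound (hx : ∀ i, IsTail (x i)) {m n : ℕ} (hm : 0 < m) (hn : 0 < n)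
    {K α : ℝ} (hK : 0 < K) (hα : 0 < α) :
    (1 / ((m : ℝ) * 2 ^ n)) * ∑ i ∈ Finset.range (m * 2 ^ n), tailPotential (polarTail x n i) ≤
      ((1 / ((m : ℝ) * 2 ^ n)) * ∑ i ∈ Finset.range (m * 2 ^ n), ∑' k, x i k) / K + 6 * α +
        3 / 2 * (1 + K) ^ 3 / α / n := by
  set C := (1 / ((m : ℝ) * 2 ^ n)) * ∑ i ∈ Finset.range (m * 2 ^ n), ∑' k, x i k with hC
  set Z := (1 / ((m : ℝ) * 2 ^ n)) *
    ∑ i ∈ Finset.range (m * 2 ^ n), tailPotential (polarTail x n i) with hZ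
  set B := 3 / 2 * (1 + K) ^ 3 / α with hB
  have hB0 : 0 ≤ B := by positivity
  have step : ∀ l < n, Z ≤ C / K + 6 * α + B *
      (meanPotential x (m * 2 ^ (n - (l + 1))) (l + 1) - meanPotential x (m * 2 ^ (n - l)) l) := by
    intro l hl
    set A := m * 2 ^ (n - (l + 1)) with hAdef
    have hA2 : m * 2 ^ (n - l) = A * 2 := by
      rw [hAdef, mul_assoc, ← pow_succ]; congr 2; omega
    have hT : m * 2 ^ n = A * 2 * 2 ^ l := by
      rw [← hA2, mul_assoc, ← pow_add]; congr 2; omega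
    have hT' : (m : ℝ) * 2 ^ n = (A * 2 : ℕ) * 2 ^ l := by exact_mod_cast hT
    have hA : 0 < A := by positivity
    have h1 : Z ≤ (1 / ((m : ℝ) * 2 ^ n)) *
        ∑ i ∈ Finset.range (m * 2 ^ n), tailPotential (polarTail x l i) := by
      have := sum_tailPotential_antitone hx m l (n - l)
      rw [show l + (n - l) = n by omega] at this
      exact mul_le_mul_of_nonneg_left this (by positivity)
    rw [hT, hT'] at h1
    refine h1.trans ((average_tailPotential_le hx hA l).trans ?_)
    have h2 : ∑ u ∈ Finset.range (2 ^ l), min (6 * positionGap x A l u) 1 ≤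
        ∑ u ∈ Finset.range (2 ^ l), (positionMean x (A * 2) l u / K + 6 * α +
          B * (positionGap x A l u ^ 2 / (1 + positionMean x (A * 2) l u) ^ 3)) :=
      Finset.sum_le_sum fun u _ => min_le_of_gain (positionMean_nonneg hx _ _ _)
        hK hα
    refine (mul_le_mul_of_nonneg_left h2 (by positivity)).trans ?_
    rw [Finset.sum_add_distrib, Finset.sum_add_distrib, ← Finset.sum_div,
      ← Finset.mul_sum _ _ B, mul_add, mul_add, mul_div_assoc',
      average_positionMean hx (A * 2) l, mul_left_comm _ B, hA2]
    have h3 := mul_le_mul_of_nonneg_left (meanPotential_gain hx A l) hB0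
    have h4 : (1 / 2 ^ l : ℝ) * ∑ u ∈ Finset.range (2 ^ l), 6 * α = 6 * α := by
      simp
    rw [h4, hC, hT, hT']
    linarith
  have hsum := Finset.sum_le_sum fun l (hl : l ∈ Finset.range n) => step l (Finset.mem_range.1 hl)
  rw [Finset.sum_add_distrib, ← Finset.mul_sum _ _ B,
    Finset.sum_range_sub (fun l => meanPotential x (m * 2 ^ (n - l)) l)] at hsum
  simp only [Finset.sum_const, Finset.card_range, nsmul_eq_mul] at hsum
  have h1 := meanPotential_le_one hx (m * 2 ^ (n - n)) n
  have h2 := meanPotential_nonneg hx (m * 2 ^ (n - 0)) 0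
  have hn' : (0 : ℝ) < n := by exact_mod_cast hn
  have h3 : B * (meanPotential x (m * 2 ^ (n - n)) n - meanPotential x (m * 2 ^ (n - 0)) 0) ≤ B := by
    nlinarith
  rw [← sub_le_iff_le_add', le_div_iff₀ hn']
  nlinarith

/-- The average potential tends to `0`, uniformly over the number `m` of blocks as long as the
average means stay bounded. -/
theorem eventually_average_tailPotential_le (hx : ∀ i, IsTail (x i)) {C ε : ℝ} (hC : 0 ≤ C)
    (hε : 0 < ε) :
    ∀ᶠ n : ℕ in atTop, ∀ m : ℕ, 0 < m →
      ∑ i ∈ Finset.range (m * 2 ^ n), ∑' k, x i k ≤ C * (m * 2 ^ n) →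
      (1 / ((m : ℝ) * 2 ^ n)) * ∑ i ∈ Finset.range (m * 2 ^ n), tailPotential (polarTail x n i)
        ≤ ε := by
  set K := 3 * (C + 1) / ε with hKdef
  have hK : 0 < K := by positivity
  set α := ε / 18 with hα
  have hα0 : 0 < α := by positivity
  have hlim : Tendsto (fun n : ℕ => 3 / 2 * (1 + K) ^ 3 / α / n) atTop (𝓝 0) :=
    tendsto_const_div_atTop_nhds_zero_nat _
  filter_upwards [hlim.eventually (gt_mem_nhds (show (0 : ℝ) < ε / 3 by positivity)),
    eventually_gt_atTop 0] with n hn hn0 m hm hC'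
  refine (average_tailPotential_bound hx hm hn0 hK hα0).trans ?_
  have hm' : (0 : ℝ) < m := by exact_mod_cast hm
  have h1 : (1 / ((m : ℝ) * 2 ^ n)) * ∑ i ∈ Finset.range (m * 2 ^ n), ∑' k, x i k ≤ C := by
    rwa [one_div, inv_mul_le_iff₀ (by positivity), mul_comm _ C]
  have h2 : ((1 / ((m : ℝ) * 2 ^ n)) * ∑ i ∈ Finset.range (m * 2 ^ n), ∑' k, x i k) / K ≤
      ε / 3 := by
    rw [div_le_iff₀ hK, show ε / 3 * K = C + 1 by rw [hKdef]; field_simp]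
    linarith
  linarith

end polarTail

/-! ### Counting the polarized indices -/

/-- `P(L = k)` for a level `L` with tail `a`. -/
noncomputable def levelMass (a : ℕ → ℝ) (k : ℕ) : ℝ := (if k = 0 then 1 else a (k - 1)) - a k

/-- The index with tail `a` is polarized to level `k`, with precision `δ`: the mean of `(L - k)⁺` is
below `δ` and the mean of `L` is within `δ` of `k`. -/
def IsPolarizedTo (a : ℕ → ℝ) (k : ℕ) (δ : ℝ) : Prop :=
  ∑' j, a (j + k) < δ ∧ |∑' j, a j - k| < δ

open Classical in
/-- The indicator of being polarized to level `k` differs from `P(L = k)` by at most a multiple of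
the potentials of the truncated levels `(L - j)⁺`, `j ≤ k`. -/
lemma abs_indicator_sub_levelMass_le {a : ℕ → ℝ} (ha : IsTail a) (k : ℕ) {δ η : ℝ}
    (hη : 0 < η) (h1 : η * (10 + 2 * k) ≤ δ) (h2 : η * (10 + 2 * k) ≤ 1 - δ) :
    |(if IsPolarizedTo a k δ then 1 else 0) - levelMass a k| ≤
      (4 + 1 / η) * ∑ j ∈ Finset.range (k + 1), tailPotential fun i => a (i + j) := by
  set S := ∑ j ∈ Finset.range (k + 1), tailPotential fun i => a (i + j) with hS
  have hk0 : (0 : ℝ) ≤ k := Nat.cast_nonneg k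
  have hZ : ∀ j ≤ k, tailPotential (fun i => a (i + j)) ≤ S := fun j hj =>
    Finset.single_le_sum (f := fun j => tailPotential fun i => a (i + j))
      (fun i _ => (ha.shift i).tailPotential_nonneg) (Finset.mem_range.2 (by omega))
  have hS0 : 0 ≤ S := Finset.sum_nonneg fun i _ => (ha.shift i).tailPotential_nonneg
  -- the two parts of the potential: variance of the event `L > j`, and mean of `(L - j)⁺`
  have hV : ∀ j ≤ k, a j * (1 - a j) ≤ S := by
    intro j hj
    have h := hZ j hj
    have h3 : a j ≤ min (∑' i, a (i + j)) 1 := by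
      refine le_min ?_ (ha.le_one j)
      simpa using (ha.shift j).zero_le_tsum
    simp only [tailPotential, zero_add] at h
    nlinarith
  have hW : min (∑' i, a (i + k)) 1 ≤ S + a k ^ 2 := by
    have h := hZ k le_rfl
    simp only [tailPotential, zero_add] at h
    linarith
  have htail : a k ≤ ∑' i, a (i + k) := by simpa using (ha.shift k).zero_le_tsum
  have hsum : ∑' j, a j - k = ∑' j, a (j + k) - ∑ j ∈ Finset.range k, (1 - a j) := by
    rw [← ha.summable.sum_add_tsum_nat_add k]; simp; ring
  set h := ∑' i, a (i + k) with hh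
  set r := ∑ j ∈ Finset.range k, (1 - a j) with hr
  have hr0 : 0 ≤ r := Finset.sum_nonneg fun j _ => by have := ha.le_one j; linarith
  have hmass0 : 0 ≤ levelMass a k := by
    unfold levelMass; split_ifs with h0
    · have := ha.le_one k; linarith
    · have := ha.anti (show k - 1 ≤ k by omega); linarith
  have hmass1 : levelMass a k ≤ 1 - a k := by
    unfold levelMass; split_ifs with h0
    · exact le_rfl
    · have := ha.le_one (k - 1); linarith
  have hak0 := ha.nonneg k
  have hak1 := ha.le_one k
  have hcoef : 4 * S + S / η = (4 + 1 / η) * S := by ring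
  have hdiv : 0 ≤ S / η := by positivity
  rw [← hcoef]
  rcases le_or_gt η S with hηS | hηS
  · have : 1 ≤ S / η := by rwa [le_div_iff₀ hη, one_mul]
    split_ifs <;> rw [abs_le] <;> constructor <;> linarith
  have hηδ : 10 * η ≤ δ := by nlinarith
  have hηδ' : 10 * η ≤ 1 - δ := by nlinarith
  rcases le_or_gt (1 / 2) (a k) with hb | hb
  · -- `L > k` is nearly certain
    have hb' := hV k le_rfl
    have : 1 - a k ≤ 2 * S := by nlinarith
    have hnot : ¬ IsPolarizedTo a k δ := fun hp => by
      have := hp.1; rw [← hh] at this; linarith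
    rw [if_neg hnot, abs_le]
    constructor <;> linarith
  · have hb' := hV k le_rfl
    have hb2 : a k ≤ 2 * S := by nlinarith
    have hsmall : h ≤ 3 * S := by
      have : min h 1 ≤ 3 * S := by nlinarith
      rcases min_le_iff.1 this with h' | h'
      · exact h'
      · linarith
    by_cases hlow : k ≠ 0 ∧ a (k - 1) < 1 / 2
    · -- `L < k` is nearly certain
      obtain ⟨hk, ha'⟩ := hlow
      have hV' := hV (k - 1) (by omega)
      have hna := ha.nonneg (k - 1)
      have ha2 : a (k - 1) ≤ 2 * S := by nlinarith
      have hr1 : 1 - a (k - 1) ≤ r :=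
        Finset.single_le_sum (f := fun j => 1 - a j)
          (fun j _ => by have := ha.le_one j; linarith) (Finset.mem_range.2 (by omega))
      have hnot : ¬ IsPolarizedTo a k δ := fun hp => by
        have := hp.2; rw [hsum, abs_lt] at this; linarith
      have hm : levelMass a k = a (k - 1) - a k := by simp [levelMass, hk]
      rw [if_neg hnot, abs_le]
      constructor <;> linarith
    · -- `L = k` is nearly certain
      have hge : ∀ j < k, 1 - a j ≤ 2 * S := by
        intro j hj
        have hbig : 1 / 2 ≤ a j := by
          have : 1 / 2 ≤ a (k - 1) := by
            by_contra hlt; exact hlow ⟨by omega, not_le.1 hlt⟩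
          exact this.trans (ha.anti (by omega))
        have := hV j hj.le
        have := ha.le_one j
        nlinarith
      have hr2 : r ≤ k * (2 * S) := by
        have := Finset.sum_le_sum fun j (hj : j ∈ Finset.range k) => hge j (Finset.mem_range.1 hj)
        rwa [Finset.sum_const, Finset.card_range, nsmul_eq_mul] at this
      have hr3 : r ≤ 2 * k * η := by nlinarith
      have hpol : IsPolarizedTo a k δ := by
        refine ⟨by rw [← hh]; linarith, ?_⟩
        rw [hsum, abs_lt]
        have : 0 ≤ h := hak0.trans htail
        constructor <;> nlinarith
      have hm : 1 - levelMass a k ≤ 4 * S := by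
        unfold levelMass
        split_ifs with h0
        · linarith
        · have := hge (k - 1) (by omega); linarith
      rw [if_pos hpol, abs_le]
      constructor <;> linarith

open Classical in
/-- The fraction of the first `m * 2 ^ n` indices that are polarized to level `k` is eventually
close to the limiting frequency `Q` of level `k` in the source. -/
theorem eventually_abs_fraction_sub_le {x : ℕ → ℕ → ℝ} (hx : ∀ i, IsTail (x i)) {C : ℝ}
    (hC : ∀ᶠ m : ℕ in atTop, ∑ i ∈ Finset.range m, ∑' j, x i j ≤ C * m) {k : ℕ} {Q : ℝ}
    (hQ : Tendsto (fun m : ℕ => (1 / (m : ℝ)) * ∑ i ∈ Finset.range m, levelMass (x i) k)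
      atTop (𝓝 Q)) {δ : ℝ} (h0 : 0 < δ) (h1 : δ < 1) {ε : ℝ} (hε : 0 < ε) :
    ∀ᶠ n : ℕ in atTop, ∀ᶠ m : ℕ in atTop,
      |(1 / ((m : ℝ) * 2 ^ n)) * (((Finset.range (m * 2 ^ n)).filter fun i =>
        IsPolarizedTo (polarTail x n i) k δ).card : ℝ) - Q| ≤ ε := by
  obtain ⟨η, hη, hη1, hη2⟩ : ∃ η : ℝ, 0 < η ∧ η * (10 + 2 * k) ≤ δ ∧ η * (10 + 2 * k) ≤ 1 - δ := by
    have hp : (0 : ℝ) < 10 + 2 * k := by positivity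
    refine ⟨min δ (1 - δ) / (10 + 2 * k), div_pos (lt_min h0 (by linarith)) hp, ?_, ?_⟩
    · rw [div_mul_cancel₀ _ hp.ne']; exact min_le_left _ _
    · rw [div_mul_cancel₀ _ hp.ne']; exact min_le_right _ _
  have hB : 0 < 4 + 1 / η := by positivity
  have hkp : (0 : ℝ) < k + 1 := by positivity
  have hev : ∀ᶠ n : ℕ in atTop, ∀ j ∈ Finset.range (k + 1), ∀ m : ℕ, 0 < m →
      ∑ i ∈ Finset.range (m * 2 ^ n), ∑' t, x i (t + j) ≤ |C| * (m * 2 ^ n) →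
      (1 / ((m : ℝ) * 2 ^ n)) * ∑ i ∈ Finset.range (m * 2 ^ n),
        tailPotential (polarTail (fun i t => x i (t + j)) n i) ≤
        ε / 2 / ((4 + 1 / η) * (k + 1)) :=
    (Finset.eventually_all _).2 fun j _ =>
      eventually_average_tailPotential_le (fun i => (hx i).shift j) (abs_nonneg C) (by positivity)
  filter_upwards [hev] with n hn
  have hmul : Tendsto (fun m : ℕ => m * 2 ^ n) atTop atTop :=
    tendsto_id.atTop_mul_const' (by positivity)
  have hQ' := (hQ.comp hmul).eventually (Metric.ball_mem_nhds Q (show 0 < ε / 2 by positivity))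
  filter_upwards [hQ', hmul.eventually hC, eventually_gt_atTop 0] with m hm1 hm2 hm0
  rw [Real.dist_eq, abs_lt] at hm1
  simp only [Function.comp_apply, Nat.cast_mul, Nat.cast_pow, Nat.cast_ofNat] at hm1 hm2
  have hm0' : (0 : ℝ) < m := by exact_mod_cast hm0
  set T : ℝ := (m : ℝ) * 2 ^ n with hT
  have hTpos : 0 < T := by positivity
  have hmassum : ∑ i ∈ Finset.range (m * 2 ^ n), levelMass (polarTail x n i) k =
      ∑ i ∈ Finset.range (m * 2 ^ n), levelMass (x i) k := by
    unfold levelMass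
    rw [Finset.sum_sub_distrib, Finset.sum_sub_distrib, sum_polarTail_apply hx]
    split_ifs
    · rfl
    · rw [sum_polarTail_apply hx]
  have hdiff : |(1 / T) * (((Finset.range (m * 2 ^ n)).filter fun i =>
        IsPolarizedTo (polarTail x n i) k δ).card : ℝ) -
      (1 / T) * ∑ i ∈ Finset.range (m * 2 ^ n), levelMass (x i) k| ≤ ε / 2 := by
    rw [← hmassum, Finset.natCast_card_filter, ← mul_sub, ← Finset.sum_sub_distrib, abs_mul,
      abs_of_pos (by positivity)]
    calc _ ≤ 1 / T * ∑ i ∈ Finset.range (m * 2 ^ n), (4 + 1 / η) *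
          ∑ j ∈ Finset.range (k + 1), tailPotential fun t => polarTail x n i (t + j) := by
          refine mul_le_mul_of_nonneg_left ((Finset.abs_sum_le_sum_abs _ _).trans
            (Finset.sum_le_sum fun i _ => ?_)) (by positivity)
          exact abs_indicator_sub_levelMass_le (isTail_polarTail hx n i) k hη hη1 hη2
      _ = (4 + 1 / η) * ∑ j ∈ Finset.range (k + 1), 1 / T * ∑ i ∈ Finset.range (m * 2 ^ n),
            tailPotential (polarTail (fun i t => x i (t + j)) n i) := by
          rw [← Finset.mul_sum, Finset.sum_comm, ← Finset.mul_sum]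
          simp only [polarTail_shift]
          ring
      _ ≤ (4 + 1 / η) * ∑ j ∈ Finset.range (k + 1), ε / 2 / ((4 + 1 / η) * (k + 1)) := by
          refine mul_le_mul_of_nonneg_left (Finset.sum_le_sum fun j hj => ?_) hB.le
          refine hn j hj m hm0 (le_trans ?_ (hm2.trans
            (mul_le_mul_of_nonneg_right (le_abs_self C) hTpos.le)))
          refine Finset.sum_le_sum fun i _ => ?_
          exact ((hx i).shift j).summable.tsum_le_tsum
            (fun t => (hx i).anti (Nat.le_add_right t j)) (hx i).summable
      _ = ε / 2 := by
          rw [Finset.sum_const, Finset.card_range, nsmul_eq_mul]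
          push_cast
          field_simp
  rw [abs_le] at hdiff ⊢
  obtain ⟨h3, h4⟩ := hm1
  constructor <;> linarith [hdiff.1, hdiff.2]

/-- Uniform closeness of a double sequence to `Q`, in the order "first `m`, then `n`", gives the
iterated limits. -/
lemma tendsto_liminf_limsup_of_eventually {F : ℕ → ℕ → ℝ} {Q : ℝ}
    (hF : ∀ ε > 0, ∀ᶠ n : ℕ in atTop, ∀ᶠ m : ℕ in atTop, |F n m - Q| ≤ ε) :
    Tendsto (fun n => liminf (F n) atTop) atTop (𝓝 Q) ∧
      Tendsto (fun n => limsup (F n) atTop) atTop (𝓝 Q) := by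
  have key : ∀ ε > 0, ∀ n, (∀ᶠ m : ℕ in atTop, |F n m - Q| ≤ ε) →
      |liminf (F n) atTop - Q| ≤ ε ∧ |limsup (F n) atTop - Q| ≤ ε := by
    intro ε _ n hn
    have hlo : ∀ᶠ m in atTop, Q - ε ≤ F n m := hn.mono fun m h => by linarith [(abs_le.1 h).1]
    have hhi : ∀ᶠ m in atTop, F n m ≤ Q + ε := hn.mono fun m h => by linarith [(abs_le.1 h).2]
    have hb1 : IsBoundedUnder (· ≥ ·) atTop (F n) := ⟨_, hlo⟩
    have hb2 : IsBoundedUnder (· ≤ ·) atTop (F n) := ⟨_, hhi⟩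
    have h1 := le_liminf_of_le hb2.isCoboundedUnder_ge hlo
    have h2 := limsup_le_of_le hb1.isCoboundedUnder_le hhi
    have h3 := liminf_le_limsup hb2 hb1
    constructor <;> rw [abs_le] <;> constructor <;> linarith
  constructor <;> rw [Metric.tendsto_atTop'] <;> intro ε hε
  all_goals
    obtain ⟨N, hN⟩ := eventually_atTop.1 (hF (ε / 2) (by positivity))
    refine ⟨N, fun n hn => ?_⟩
    have := key _ (by positivity) n (hN n hn.le)
    rw [Real.dist_eq]
  · linarith [this.1]
  · linarith [this.2]

open Classical in
/-- If all source tails agree, the polarized tails are periodic in the index, so that the fraction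
of polarized indices does not depend on the number of blocks. -/
lemma tendsto_fraction_of_constant {x : ℕ → ℕ → ℝ} (hx : ∀ i j, x i = x j) (P : (ℕ → ℝ) → Prop)
    (n : ℕ) :
    Tendsto (fun m : ℕ => (1 / ((m : ℝ) * 2 ^ n)) * (((Finset.range (m * 2 ^ n)).filter fun i =>
        P (polarTail x n i)).card : ℝ)) atTop
      (𝓝 ((1 / 2 ^ n) * (((Finset.range (2 ^ n)).filter fun i => P (polarTail x n i)).card : ℝ))) :=
    by
  refine tendsto_const_nhds.congr' ?_
  filter_upwards [eventually_gt_atTop 0] with m hm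
  have hm' : (0 : ℝ) < m := by exact_mod_cast hm
  rw [Finset.natCast_card_filter, Finset.natCast_card_filter, sum_range_mul_eq]
  have : ∀ c ∈ Finset.range m, ∑ r ∈ Finset.range (2 ^ n),
      (if P (polarTail x n (2 ^ n * c + r)) then (1 : ℝ) else 0) =
      ∑ r ∈ Finset.range (2 ^ n), if P (polarTail x n r) then (1 : ℝ) else 0 :=
    fun c _ => Finset.sum_congr rfl fun r hr => by
      unfold polarTail
      rw [polarRec_shift hx n c r (Finset.mem_range.1 hr)]
  rw [Finset.sum_congr rfl this, Finset.sum_const, Finset.card_range, nsmul_eq_mul]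
  field_simp

/-! ### Subgroups of the Prüfer group -/

/-- The properties of the Prüfer `p`-group on which the argument rests: it is a `p`-group, has at
most `n` solutions of `x ^ n = 1` for each `n`, and has elements of every order `p ^ k`. -/
structure IsPruferGroup (p : ℕ) (G : Type*) [CommGroup G] : Prop where
  isPGroup : IsPGroup p G
  finite_torsion : ∀ n, 0 < n → {x : G | x ^ n = 1}.Finite
  ncard_torsion_le : ∀ n, 0 < n → {x : G | x ^ n = 1}.ncard ≤ n
  exists_orderOf : ∀ k, ∃ g : G, orderOf g = p ^ k

lemma isPruferGroup_of_mulEquiv {p : ℕ} [hp : Fact p.Prime] {G : Type*} [CommGroup G]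
    (e : G ≃* Multiplicative (Prufer p)) : IsPruferGroup p G := by
  have : Fact ((0 : ℚ) < 1) := ⟨one_pos⟩
  let ι : G → AddCircle (1 : ℚ) := fun g => (Multiplicative.toAdd (e g)).1
  have hι : Function.Injective ι := fun a b h =>
    e.injective (Multiplicative.toAdd.injective (Subtype.ext h))
  have hpow : ∀ (g : G) (n : ℕ), ι (g ^ n) = n • ι g := fun g n => by
    simp only [ι, map_pow, toAdd_pow]; rfl
  have hone : ι 1 = 0 := by simp only [ι, map_one, toAdd_one]; rfl
  have hsub : ∀ n, 0 < n → {x : G | x ^ n = 1} ⊆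
      ι ⁻¹' ((Finset.range n).image fun m : ℕ => (((m : ℚ) / n * 1 : ℚ) : AddCircle (1 : ℚ))) := by
    intro n hn x hx
    have h0 : n • ι x = 0 := by rw [← hpow, show x ^ n = 1 from hx, hone]
    obtain ⟨m, hm, hmx⟩ := (AddCircle.nsmul_eq_zero_iff hn).1 h0
    simp only [Set.mem_preimage, Finset.coe_image, Set.mem_image]
    exact ⟨m, by simpa using hm, hmx⟩
  refine ⟨fun g => ?_, fun n hn => ?_, fun n hn => ?_, fun k => ?_⟩
  · obtain ⟨k, hk⟩ := AddCommGroup.mem_primaryComponent.1 (Multiplicative.toAdd (e g)).2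
    exact ⟨k, hι (by rw [hpow, hone]; exact hk)⟩
  · exact ((Finset.finite_toSet _).preimage hι.injOn).subset (hsub n hn)
  · calc _ ≤ (ι ⁻¹' ((Finset.range n).image
          fun m : ℕ => (((m : ℚ) / n * 1 : ℚ) : AddCircle (1 : ℚ)))).ncard :=
        Set.ncard_le_ncard (hsub n hn) ((Finset.finite_toSet _).preimage hι.injOn)
      _ ≤ (((Finset.range n).image
          fun m : ℕ => (((m : ℚ) / n * 1 : ℚ) : AddCircle (1 : ℚ))) : Set _).ncard :=
        Set.ncard_le_ncard_of_injOn ι (fun _ h => h) hι.injOn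
      _ ≤ n := by
        rw [Set.ncard_coe_finset]
        exact Finset.card_image_le.trans (by simp)
  · have hpk : 0 < p ^ k := pow_pos hp.out.pos k
    have hord := AddCircle.addOrderOf_period_div (p := (1 : ℚ)) hpk
    set z : AddCircle (1 : ℚ) := (((1 : ℚ) / (p ^ k : ℕ) : ℚ) : AddCircle (1 : ℚ)) with hz
    have hmem : z ∈ AddCommGroup.primaryComponent (ℚ ⧸ AddSubgroup.zmultiples (1 : ℚ)) p :=
      AddCommGroup.mem_primaryComponent_iff_addOrderOf.2 ⟨k, hord⟩
    refine ⟨e.symm (Multiplicative.ofAdd ⟨z, hmem⟩), ?_⟩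
    rw [MulEquiv.orderOf_eq, orderOf_ofAdd_eq_addOrderOf, ← AddSubgroup.addOrderOf_coe]
    exact hord

/-- The subgroup of the solutions of `x ^ p ^ k = 1`; in the Prüfer group, the subgroup of order
`p ^ k`. -/
def primeTorsion (p : ℕ) (G : Type*) [CommGroup G] (k : ℕ) : Subgroup G :=
  (powMonoidHom (p ^ k)).ker

section Prufer

variable {p : ℕ} [hp : Fact p.Prime] {G : Type*} [CommGroup G]

omit hp in
lemma mem_primeTorsion {k : ℕ} {g : G} : g ∈ primeTorsion p G k ↔ g ^ p ^ k = 1 := Iff.rfl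

omit hp in
lemma primeTorsion_mono : Monotone (primeTorsion p G) := fun i j hij g hg => by
  rw [mem_primeTorsion] at *
  rw [← Nat.add_sub_of_le hij, pow_add, pow_mul, hg, one_pow]

namespace IsPruferGroup

variable (hG : IsPruferGroup p G)
include hG

omit hp in
/-- A subgroup of order `n` already contains all solutions of `x ^ n = 1`. -/
lemma coe_eq_torsion (n : ℕ) (hn : 0 < n) (H : Subgroup G) (hH : Nat.card H = n) :
    (H : Set G) = {x : G | x ^ n = 1} := by
  refine Set.eq_of_subset_of_ncard_le (fun x hx => ?_) ?_ (hG.finite_torsion n hn)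
  · have : (⟨x, hx⟩ : H) ^ n = 1 := by rw [← hH]; exact pow_card_eq_one'
    exact congrArg Subtype.val this
  · refine (hG.ncard_torsion_le n hn).trans ?_
    rw [← hH]; rfl

lemma finite_primeTorsion (k : ℕ) : Finite (primeTorsion p G k) :=
  (hG.finite_torsion (p ^ k) (pow_pos hp.out.pos k)).to_subtype

lemma card_primeTorsion (k : ℕ) : Nat.card (primeTorsion p G k) = p ^ k := by
  obtain ⟨g, hg⟩ := hG.exists_orderOf k
  have h := hG.coe_eq_torsion (p ^ k) (pow_pos hp.out.pos k) (Subgroup.zpowers g)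
    (by rw [Nat.card_zpowers, hg])
  have : primeTorsion p G k = Subgroup.zpowers g := SetLike.coe_injective h.symm
  rw [this, Nat.card_zpowers, hg]

lemma exists_eq_primeTorsion (H : Subgroup G) [Finite H] : ∃ k, H = primeTorsion p G k := by
  obtain ⟨k, hk⟩ := IsPGroup.iff_card.1 (hG.isPGroup.to_subgroup H)
  exact ⟨k, SetLike.coe_injective (hG.coe_eq_torsion _ (pow_pos hp.out.pos k) H hk)⟩

lemma primeTorsion_injective : Function.Injective (primeTorsion p G) := fun i j h => by
  have := hG.card_primeTorsion i
  rw [h, hG.card_primeTorsion j] at this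
  exact (Nat.pow_right_injective hp.out.two_le this).symm

lemma mem_zpowers_or (x y : G) : x ∈ Subgroup.zpowers y ∨ y ∈ Subgroup.zpowers x := by
  have key : ∀ x y : G, ∀ a b, orderOf x = p ^ a → orderOf y = p ^ b → a ≤ b →
      x ∈ Subgroup.zpowers y := by
    intro x y a b hx hy hab
    have h := hG.coe_eq_torsion (p ^ b) (pow_pos hp.out.pos b) (Subgroup.zpowers y)
      (by rw [Nat.card_zpowers, hy])
    rw [← SetLike.mem_coe, h]
    exact orderOf_dvd_iff_pow_eq_one.1 (hx ▸ pow_dvd_pow p hab)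
  obtain ⟨a, ha⟩ := IsPGroup.iff_orderOf.1 hG.isPGroup x
  obtain ⟨b, hb⟩ := IsPGroup.iff_orderOf.1 hG.isPGroup y
  rcases le_total a b with h | h
  · exact Or.inl (key x y a b ha hb h)
  · exact Or.inr (key y x b a hb ha h)

/-- The subgroups form a chain. -/
lemma le_or_le (H K : Subgroup G) : H ≤ K ∨ K ≤ H := by
  by_contra hcon
  rw [not_or, SetLike.not_le_iff_exists, SetLike.not_le_iff_exists] at hcon
  obtain ⟨⟨x, hxH, hxK⟩, y, hyK, hyH⟩ := hcon
  rcases hG.mem_zpowers_or x y with h | h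
  · exact hxK ((Subgroup.zpowers_le.2 hyK) h)
  · exact hyH ((Subgroup.zpowers_le.2 hxH) h)

end IsPruferGroup

/-! ### Finite cosets and their levels -/

/-- The exponent `k` such that a finite coset is a coset of the subgroup of order `p ^ k`. -/
noncomputable def cosetLevel (p : ℕ) {G : Type*} [Group G] (S : FiniteCoset G) : ℕ :=
  Nat.log p S.1.ncard

lemma ncard_smul_subgroup {G : Type*} [Group G] (g : G) (H : Subgroup G) :
    (g • (H : Set G)).ncard = Nat.card H := by
  rw [Set.ncard_smul_set]; rfl

namespace IsPruferGroup

variable (hG : IsPruferGroup p G)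
include hG

lemma exists_coset_eq (S : FiniteCoset G) :
    ∃ g : G, S.1 = g • (primeTorsion p G (cosetLevel p S) : Set G) := by
  obtain ⟨S, H, _, hfin, g, rfl⟩ := S
  obtain ⟨k, rfl⟩ := hG.exists_eq_primeTorsion H
  refine ⟨g, ?_⟩
  simp only [cosetLevel, ncard_smul_subgroup, hG.card_primeTorsion, Nat.log_pow hp.out.one_lt]

lemma mem_cosetsOf_iff (S : FiniteCoset G) (k : ℕ) :
    S ∈ cosetsOf (primeTorsion p G k) ↔ cosetLevel p S = k := by
  constructor
  · rintro ⟨g, hg⟩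
    rw [cosetLevel, hg, ncard_smul_subgroup, hG.card_primeTorsion, Nat.log_pow hp.out.one_lt]
  · rintro rfl
    exact hG.exists_coset_eq S

lemma smul_mem_coset_iff (S : FiniteCoset G) {h : G} (hh : h ∈ primeTorsion p G (cosetLevel p S))
    (x : G) : h * x ∈ S.1 ↔ x ∈ S.1 := by
  obtain ⟨g, hg⟩ := hG.exists_coset_eq S
  rw [hg, mem_leftCoset_iff, mem_leftCoset_iff, mul_left_comm]
  exact Subgroup.mul_mem_cancel_left _ hh

lemma div_mem_of_mem_coset (S : FiniteCoset G) {x y : G} (hx : x ∈ S.1) (hy : y ∈ S.1) :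
    x / y ∈ primeTorsion p G (cosetLevel p S) := by
  obtain ⟨g, hg⟩ := hG.exists_coset_eq S
  rw [hg, mem_leftCoset_iff] at hx hy
  have := Subgroup.div_mem _ hx hy
  rwa [mul_div_mul_left_eq_div] at this

end IsPruferGroup

/-! ### The polar transform of a product of subgroups -/

/-- The polar transform of a deterministic vector. -/
def polarVec (x : ℕ → G) (n i : ℕ) : G := polarRec (· * ·) (fun _ b => b) x n i

/-- The level of the subgroup describing the `i`-th polarized symbol, given the source levels. -/
def polarLevel (l : ℕ → ℕ) (n i : ℕ) : ℕ := polarRec max min l n i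

omit hp in
lemma polarTransform_apply {Ω : Type*} (X : ℕ → Ω → G) (n i : ℕ) (ω : Ω) :
    polarTransform X n i ω = polarVec (fun j => X j ω) n i := by
  induction n generalizing i with
  | zero => rfl
  | succ n ih =>
    rw [polarTransform, polarVec, polarRec]
    split_ifs
    · exact congrArg₂ (· * ·) (ih _) (ih _)
    · exact ih _

lemma polarVec_even (x : ℕ → G) (n c : ℕ) {j : ℕ} (hj : j < 2 ^ n) :
    polarVec x (n + 1) (2 ^ (n + 1) * c + 2 * j) =
      polarVec x n (2 ^ n * (2 * c) + j) * polarVec x n (2 ^ n * (2 * c + 1) + j) := by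
  rw [polarVec, polarRec_even n c hj, show 2 ^ (n + 1) * c + j + 2 ^ n =
    2 ^ n * (2 * c + 1) + j by ring, show 2 ^ (n + 1) * c + j = 2 ^ n * (2 * c) + j by ring]
  rfl

lemma polarVec_odd (x : ℕ → G) (n c : ℕ) {j : ℕ} (hj : j < 2 ^ n) :
    polarVec x (n + 1) (2 ^ (n + 1) * c + (2 * j + 1)) =
      polarVec x n (2 ^ n * (2 * c + 1) + j) := by
  rw [polarVec, polarRec_odd n c hj, show 2 ^ (n + 1) * c + j + 2 ^ n =
    2 ^ n * (2 * c + 1) + j by ring]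
  rfl

lemma polarLevel_even (l : ℕ → ℕ) (n c : ℕ) {j : ℕ} (hj : j < 2 ^ n) :
    polarLevel l (n + 1) (2 ^ (n + 1) * c + 2 * j) =
      max (polarLevel l n (2 ^ n * (2 * c) + j)) (polarLevel l n (2 ^ n * (2 * c + 1) + j)) := by
  rw [polarLevel, polarRec_even n c hj, show 2 ^ (n + 1) * c + j + 2 ^ n =
    2 ^ n * (2 * c + 1) + j by ring, show 2 ^ (n + 1) * c + j = 2 ^ n * (2 * c) + j by ring]
  rfl

lemma polarLevel_odd (l : ℕ → ℕ) (n c : ℕ) {j : ℕ} (hj : j < 2 ^ n) :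
    polarLevel l (n + 1) (2 ^ (n + 1) * c + (2 * j + 1)) =
      min (polarLevel l n (2 ^ n * (2 * c) + j)) (polarLevel l n (2 ^ n * (2 * c + 1) + j)) := by
  rw [polarLevel, polarRec_odd n c hj, show 2 ^ (n + 1) * c + j + 2 ^ n =
    2 ^ n * (2 * c + 1) + j by ring, show 2 ^ (n + 1) * c + j = 2 ^ n * (2 * c) + j by ring]
  rfl

lemma polarVec_mul (x y : ℕ → G) (n i : ℕ) :
    polarVec (x * y) n i = polarVec x n i * polarVec y n i := by
  induction n generalizing i with
  | zero => rfl
  | succ n ih =>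
    obtain ⟨c, j, hj, rfl | rfl⟩ := exists_even_or_odd n i
    · simp only [polarVec_even _ n c hj, ih]; exact mul_mul_mul_comm _ _ _ _
    · simp only [polarVec_odd _ n c hj, ih]

lemma polarVec_one (n i : ℕ) : polarVec (1 : ℕ → G) n i = 1 :=
  polarRec_induction (P := fun g : G => g = 1) (fun a b ha hb => by simp [ha, hb])
    (fun _ _ _ hb => hb) (fun _ => rfl) n i

lemma polarVec_div (x y : ℕ → G) (n i : ℕ) :
    polarVec (x / y) n i = polarVec x n i / polarVec y n i := by
  rw [eq_div_iff_mul_eq', ← polarVec_mul, div_mul_cancel]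

/-- A vector supported on the block `c` has trivial transform in every other block. -/
lemma polarVec_eq_one_of_ne {x : ℕ → G} {n c c' s : ℕ} (hs : s < 2 ^ n) (hc : c' ≠ c)
    (hx : ∀ d ≠ c, ∀ t < 2 ^ n, x (2 ^ n * d + t) = 1) : polarVec x n (2 ^ n * c' + s) = 1 := by
  rw [← polarVec_one (G := G) n (2 ^ n * c' + s)]
  exact polarRec_congr hs fun t ht => hx c' hc t ht

omit hp in
/-- If the earlier entries of a block vanish, then the next one lies in the subgroup given by
`polarLevel`. -/
lemma polarVec_mem {x : ℕ → G} {l : ℕ → ℕ} {n c r : ℕ}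
    (hx : ∀ t < 2 ^ n, x (2 ^ n * c + t) ∈ primeTorsion p G (l (2 ^ n * c + t)))
    (hr : r < 2 ^ n) (h0 : ∀ s < r, polarVec x n (2 ^ n * c + s) = 1) :
    polarVec x n (2 ^ n * c + r) ∈ primeTorsion p G (polarLevel l n (2 ^ n * c + r)) := by
  induction n generalizing c r with
  | zero => exact hx _ hr
  | succ n ih =>
    have h2 : 2 ^ (n + 1) = 2 * 2 ^ n := by ring
    have hx1 : ∀ t < 2 ^ n, x (2 ^ n * (2 * c) + t) ∈
        primeTorsion p G (l (2 ^ n * (2 * c) + t)) := fun t ht => by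
      have := hx t (by omega)
      rwa [show 2 ^ (n + 1) * c + t = 2 ^ n * (2 * c) + t by ring] at this
    have hx2 : ∀ t < 2 ^ n, x (2 ^ n * (2 * c + 1) + t) ∈
        primeTorsion p G (l (2 ^ n * (2 * c + 1) + t)) := fun t ht => by
      have := hx (2 ^ n + t) (by omega)
      rwa [show 2 ^ (n + 1) * c + (2 ^ n + t) = 2 ^ n * (2 * c + 1) + t by ring] at this
    obtain ⟨j, hj, hrj⟩ : ∃ j < 2 ^ n, r = 2 * j ∨ r = 2 * j + 1 := ⟨r / 2, by omega, by omega⟩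
    have hsnd : ∀ s < j, polarVec x n (2 ^ n * (2 * c + 1) + s) = 1 := fun s hs => by
      rw [← polarVec_odd x n c (hs.trans hj)]
      exact h0 _ (by omega)
    have hfst : ∀ s < j, polarVec x n (2 ^ n * (2 * c) + s) = 1 := fun s hs => by
      have := h0 (2 * s) (by omega)
      rwa [polarVec_even x n c (hs.trans hj), hsnd s hs, mul_one] at this
    have h1 := ih hx1 hj hfst
    have h1' := ih hx2 hj hsnd
    rcases hrj with rfl | rfl
    · rw [polarVec_even x n c hj, polarLevel_even l n c hj]
      exact Subgroup.mul_mem _ (primeTorsion_mono (le_max_left _ _) h1)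
        (primeTorsion_mono (le_max_right _ _) h1')
    · rw [polarVec_odd x n c hj, polarLevel_odd l n c hj]
      -- the product of the two halves is trivial, so both lie in the intersection
      have hprod := h0 (2 * j) (by omega)
      rw [polarVec_even x n c hj] at hprod
      have h1'' := Subgroup.inv_mem _ h1
      rw [← eq_inv_of_mul_eq_one_right hprod] at h1''
      rcases min_choice (polarLevel l n (2 ^ n * (2 * c) + j))
        (polarLevel l n (2 ^ n * (2 * c + 1) + j)) with h | h <;> rw [h]
      · exact h1''
      · exact h1'

omit hp in
/-- Every element of the subgroup given by `polarLevel` occurs as an entry of a transform whose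
earlier entries vanish. -/
lemma exists_polarVec_eq (l : ℕ → ℕ) {n c r : ℕ} (hr : r < 2 ^ n) {h : G}
    (hh : h ∈ primeTorsion p G (polarLevel l n (2 ^ n * c + r))) :
    ∃ x : ℕ → G, (∀ j, x j ∈ primeTorsion p G (l j)) ∧
      (∀ d ≠ c, ∀ t < 2 ^ n, x (2 ^ n * d + t) = 1) ∧
      (∀ s < r, polarVec x n (2 ^ n * c + s) = 1) ∧ polarVec x n (2 ^ n * c + r) = h := by
  induction n generalizing c r h with
  | zero =>
    obtain rfl : r = 0 := by simpa using hr
    refine ⟨Pi.mulSingle c h, fun j => ?_, fun d hd t ht => ?_, by simp, ?_⟩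
    · by_cases hj : j = c
      · subst hj; simpa [polarLevel, polarRec_zero] using hh
      · rw [Pi.mulSingle_eq_of_ne hj]; exact Subgroup.one_mem _
    · obtain rfl : t = 0 := by simpa using ht
      simpa using Pi.mulSingle_eq_of_ne (M := fun _ : ℕ => G) hd h
    · simp [polarVec, polarRec_zero]
  | succ n ih =>
    have h2 : 2 ^ (n + 1) = 2 * 2 ^ n := by ring
    obtain ⟨j, hj, hrj⟩ : ∃ j < 2 ^ n, r = 2 * j ∨ r = 2 * j + 1 := ⟨r / 2, by omega, by omega⟩
    -- a vector supported on a half of the block is supported on the block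
    have hsupp : ∀ (x : ℕ → G) (c' : ℕ), c' = 2 * c ∨ c' = 2 * c + 1 →
        (∀ d ≠ c', ∀ t < 2 ^ n, x (2 ^ n * d + t) = 1) →
        ∀ d ≠ c, ∀ t < 2 ^ (n + 1), x (2 ^ (n + 1) * d + t) = 1 := by
      intro x c' hc' hx d hd t ht
      rcases lt_or_ge t (2 ^ n) with ht' | ht'
      · have := hx (2 * d) (by omega) t ht'
        rwa [show 2 ^ n * (2 * d) + t = 2 ^ (n + 1) * d + t by ring] at this
      · have := hx (2 * d + 1) (by omega) (t - 2 ^ n) (by omega)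
        rwa [show 2 ^ n * (2 * d + 1) + (t - 2 ^ n) = 2 ^ (n + 1) * d + (2 ^ n + (t - 2 ^ n)) by ring,
          Nat.add_sub_of_le ht'] at this
    -- the earlier entries vanish if those of both halves do, up to the last pair
    have hearly : ∀ x : ℕ → G, (∀ s < j, polarVec x n (2 ^ n * (2 * c) + s) = 1) →
        (∀ s < j, polarVec x n (2 ^ n * (2 * c + 1) + s) = 1) →
        ∀ s < 2 * j, polarVec x (n + 1) (2 ^ (n + 1) * c + s) = 1 := by
      intro x hx1 hx2 s hs
      obtain ⟨t, ht, hst⟩ : ∃ t < j, s = 2 * t ∨ s = 2 * t + 1 := ⟨s / 2, by omega, by omega⟩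
      rcases hst with rfl | rfl
      · rw [polarVec_even x n c (ht.trans hj), hx1 t ht, hx2 t ht, mul_one]
      · rw [polarVec_odd x n c (ht.trans hj), hx2 t ht]
    rcases hrj with rfl | rfl
    · rw [polarLevel_even l n c hj] at hh
      rcases max_choice (polarLevel l n (2 ^ n * (2 * c) + j))
        (polarLevel l n (2 ^ n * (2 * c + 1) + j)) with hm | hm <;> rw [hm] at hh
      · obtain ⟨x, hx1, hx2, hx3, hx4⟩ := ih hj hh
        have hother : ∀ s < 2 ^ n, polarVec x n (2 ^ n * (2 * c + 1) + s) = 1 := fun s hs =>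
          polarVec_eq_one_of_ne hs (by omega) hx2
        refine ⟨x, hx1, hsupp x _ (Or.inl rfl) hx2,
          hearly x hx3 fun s hs => hother s (hs.trans hj), ?_⟩
        rw [polarVec_even x n c hj, hx4, hother j hj, mul_one]
      · obtain ⟨x, hx1, hx2, hx3, hx4⟩ := ih hj hh
        have hother : ∀ s < 2 ^ n, polarVec x n (2 ^ n * (2 * c) + s) = 1 := fun s hs =>
          polarVec_eq_one_of_ne hs (by omega) hx2
        refine ⟨x, hx1, hsupp x _ (Or.inr rfl) hx2,
          hearly x (fun s hs => hother s (hs.trans hj)) hx3, ?_⟩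
        rw [polarVec_even x n c hj, hx4, hother j hj, one_mul]
    · rw [polarLevel_odd l n c hj] at hh
      -- take `h⁻¹` from the first half and `h` from the second one
      obtain ⟨x, hx1, hx2, hx3, hx4⟩ := ih (c := 2 * c) hj
        (Subgroup.inv_mem _ (primeTorsion_mono (min_le_left _ _) hh))
      obtain ⟨y, hy1, hy2, hy3, hy4⟩ := ih (c := 2 * c + 1) hj
        (primeTorsion_mono (min_le_right _ _) hh)
      have hxo : ∀ s < 2 ^ n, polarVec x n (2 ^ n * (2 * c + 1) + s) = 1 := fun s hs =>
        polarVec_eq_one_of_ne hs (by omega) hx2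
      have hyo : ∀ s < 2 ^ n, polarVec y n (2 ^ n * (2 * c) + s) = 1 := fun s hs =>
        polarVec_eq_one_of_ne hs (by omega) hy2
      refine ⟨x * y, fun i => Subgroup.mul_mem _ (hx1 i) (hy1 i), fun d hd t ht => ?_,
        fun s hs => ?_, ?_⟩
      · rw [Pi.mul_apply, hsupp x _ (Or.inl rfl) hx2 d hd t ht,
          hsupp y _ (Or.inr rfl) hy2 d hd t ht, mul_one]
      · rcases Nat.lt_succ_iff_lt_or_eq.1 hs with hs' | rfl
        · refine hearly _ (fun s hs => ?_) (fun s hs => ?_) s hs'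
          · rw [polarVec_mul, hx3 s hs, hyo s (hs.trans hj), mul_one]
          · rw [polarVec_mul, hxo s (hs.trans hj), hy3 s hs, mul_one]
        · rw [polarVec_even _ n c hj, polarVec_mul, polarVec_mul, hx4, hyo j hj, hxo j hj, hy4]
          simp
      · rw [polarVec_odd _ n c hj, polarVec_mul, hxo j hj, hy4, one_mul]

end Prufer

/-! ### Entropy of uniform distributions on cosets -/

section Entropy

variable {A : Type*} [CommGroup A] [Countable A] [MeasurableSpace A] [MeasurableSingletonClass A]

/-- `ν` is the uniform distribution on a coset of `N`, expressed by invariance and support. -/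
structure IsUniformOnCoset (ν : Measure A) (N : Subgroup A) : Prop where
  invariant : ∀ h ∈ N, ∀ u, ν {h * u} = ν {u}
  support : ∃ c, ∀ u, ν {u} ≠ 0 → u / c ∈ N

lemma IsUniformOnCoset.tsum_negMulLog {ν : Measure A} [IsProbabilityMeasure ν] {N : Subgroup A}
    [Finite N] (hν : IsUniformOnCoset ν N) :
    ∑' u, ENNReal.ofReal (Real.negMulLog (ν.real {u})) = ENNReal.ofReal (Real.log (Nat.card N)) := by
  obtain ⟨c, hc⟩ := hν.support
  have := Fintype.ofFinite N
  have hinj : Function.Injective fun n : N => (n : A) * c := fun a b h =>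
    Subtype.ext (mul_right_cancel h)
  have hrange : ∀ u, ν {u} ≠ 0 → u ∈ Set.range fun n : N => (n : A) * c := fun u hu =>
    ⟨⟨u / c, hc u hu⟩, div_mul_cancel u c⟩
  have hval : ∀ n : N, ν {(n : A) * c} = ν {c} := fun n => hν.invariant n n.2 c
  have htot : ∑' u, ν {u} = 1 := by
    have := lintegral_countable' (μ := ν) (fun _ : A => (1 : ℝ≥0∞))
    simpa using this.symm
  have hmass : (Nat.card N : ℝ≥0∞) * ν {c} = 1 := by
    rw [← htot, ← hinj.tsum_eq (f := fun u => ν {u}) (fun u hu => hrange u hu)]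
    simp [hval, tsum_fintype]
  have hq : (0 : ℝ) < Nat.card N := by exact_mod_cast Nat.card_pos
  have hreal : ν.real {c} = 1 / (Nat.card N : ℝ) := by
    have := congrArg ENNReal.toReal hmass
    rw [ENNReal.toReal_mul, ENNReal.toReal_natCast, ENNReal.toReal_one] at this
    rw [eq_div_iff hq.ne', mul_comm]; exact this
  have hvalr : ∀ n : N, ν.real {(n : A) * c} = 1 / (Nat.card N : ℝ) := fun n => by
    rw [← hreal, Measure.real, Measure.real, hval]
  rw [← hinj.tsum_eq (f := fun u => ENNReal.ofReal (Real.negMulLog (ν.real {u})))]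
  · simp only [hvalr]
    rw [tsum_fintype, Finset.sum_const, nsmul_eq_mul, Finset.card_univ, ← Nat.card_eq_fintype_card,
      ← ENNReal.ofReal_natCast, ← ENNReal.ofReal_mul hq.le, Real.negMulLog, one_div, Real.log_inv]
    congr 1
    field_simp
  · intro u hu
    refine hrange u fun h0 => hu ?_
    simp [Measure.real, h0]

/-- The image of a uniform distribution on a coset under a homomorphism is of the same kind. -/
lemma IsUniformOnCoset.map {B : Type*} [CommGroup B] [MeasurableSpace B]
    [MeasurableSingletonClass B] {ν : Measure A} {N : Subgroup A} (hν : IsUniformOnCoset ν N)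
    (f : A →* B) : IsUniformOnCoset (ν.map f) (N.map f) := by
  have hf : Measurable f := .of_discrete
  refine ⟨?_, ?_⟩
  · rintro _ ⟨h, hh, rfl⟩ u
    have hinv : ν.map (fun x => h * x) = ν := by
      refine Measure.ext_of_singleton fun x => ?_
      rw [Measure.map_apply .of_discrete (measurableSet_singleton x),
        ← hν.invariant h⁻¹ (N.inv_mem hh) x]
      congr 1; ext y
      simp [eq_inv_mul_iff_mul_eq]
    rw [Measure.map_apply hf (measurableSet_singleton _),
      Measure.map_apply hf (measurableSet_singleton _)]
    conv_lhs => rw [← hinv, Measure.map_apply .of_discrete (Set.to_countable _).measurableSet]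
    congr 1; ext y
    simp
  · obtain ⟨c, hc⟩ := hν.support
    refine ⟨f c, fun u hu => ?_⟩
    rw [Measure.map_apply hf (measurableSet_singleton _)] at hu
    obtain ⟨y, hy, hy0⟩ : ∃ y ∈ f ⁻¹' {u}, ν {y} ≠ 0 := by
      by_contra! hcon
      refine hu ((measure_null_iff_singleton (Set.to_countable _)).2 hcon)
    rw [Set.mem_preimage, Set.mem_singleton_iff] at hy
    exact ⟨y / c, hc y hy0, by rw [map_div, hy]⟩

end Entropy

/-- The subgroup of order `p ^ l` has `p ^ (l - k)` elements modulo that of order `p ^ k`; the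
truncated subtraction covers `l ≤ k`. -/
lemma IsPruferGroup.card_map_mk {p : ℕ} [hp : Fact p.Prime] {G : Type*} [CommGroup G]
    (hG : IsPruferGroup p G) (l k : ℕ) :
    Nat.card ((primeTorsion p G l).map (QuotientGroup.mk' (primeTorsion p G k))) = p ^ (l - k) := by
  rw [← Subgroup.relIndex_ker, QuotientGroup.ker_mk', ← Subgroup.inf_relIndex_right]
  have hinf : primeTorsion p G k ⊓ primeTorsion p G l = primeTorsion p G (min k l) :=
    (primeTorsion_mono.map_inf k l).symm
  have h := Subgroup.relIndex_mul_relIndex ⊥ (primeTorsion p G k ⊓ primeTorsion p G l)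
    (primeTorsion p G l) bot_le inf_le_right
  rw [Subgroup.relIndex_bot_left, Subgroup.relIndex_bot_left, hG.card_primeTorsion, hinf,
    hG.card_primeTorsion] at h
  have hpos := hp.out.pos
  rw [hinf]
  refine Nat.eq_of_mul_eq_mul_left (pow_pos hpos (min k l)) (h.trans ?_)
  rw [← pow_add]; congr 1; omega

/-! ### The conditional distribution of a polarized symbol -/

lemma measurable_polarLevel {Ω : Type*} [MeasurableSpace Ω] {l : ℕ → Ω → ℕ}
    (hl : ∀ i, Measurable (l i)) (n i : ℕ) :
    Measurable fun ω => polarLevel (fun j => l j ω) n i := by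
  induction n generalizing i with
  | zero => exact hl i
  | succ n ih =>
    obtain ⟨c, j, hj, rfl | rfl⟩ := exists_even_or_odd n i
    · simp only [polarLevel_even _ n c hj]; exact (ih _).max (ih _)
    · simp only [polarLevel_odd _ n c hj]; exact (ih _).min (ih _)

lemma FiniteCoset.finite {G : Type*} [Group G] (S : FiniteCoset G) : S.1.Finite := by
  obtain ⟨S, H, _, hfin, g, rfl⟩ := S
  exact (Set.toFinite (H : Set G)).smul_set

instance instCountableFiniteCoset {G : Type u} [Group G] [Countable G] :
    Countable (FiniteCoset G) := by
  refine Function.Injective.countable (f := fun S : FiniteCoset G => S.finite.toFinset) fun S T h => Subtype.ext ?_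
  exact Set.Finite.toFinset_inj.1 h

instance instDiscreteFiniteCoset {G : Type u} [Group G] :
    DiscreteMeasurableSpace (FiniteCoset G) := ⟨fun _ => trivial⟩

lemma ncard_singleton_inter {α : Type*} (g : α) (S : Set α) [Decidable (g ∈ S)] :
    ({g} ∩ S).ncard = if g ∈ S then 1 else 0 := by
  split_ifs with h
  · rw [Set.inter_eq_left.2 (Set.singleton_subset_iff.2 h), Set.ncard_singleton]
  · rw [Set.singleton_inter_eq_empty.2 h, Set.ncard_empty]

section Source

variable {p : ℕ} [hp : Fact p.Prime] {G : Type u} [CommGroup G] [Countable G]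
  [MeasurableSpace G] [StandardBorelSpace G]
  {Ω : Type v} [MeasurableSpace Ω] {μ : Measure Ω} [IsProbabilityMeasure μ]

variable (hG : IsPruferGroup p G)
include hG

/-- Given the side information, an erased symbol is uniform on a coset. -/
lemma IsErasure.ae_isUniformOnCoset {X : Ω → G} {Y : Ω → FiniteCoset G} (h : IsErasure X Y μ) :
    ∀ᵐ ω ∂μ, IsUniformOnCoset (condDistrib X Y μ (Y ω)) (primeTorsion p G (cosetLevel p (Y ω))) ∧
      ∀ u, condDistrib X Y μ (Y ω) {u} ≠ 0 → u ∈ (Y ω).1 := by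
  classical
  filter_upwards [ae_all_iff.2 fun g : G => h {g} (measurableSet_singleton g)] with ω hω
  simp only [ncard_singleton_inter] at hω
  have hsupp : ∀ u, condDistrib X Y μ (Y ω) {u} ≠ 0 → u ∈ (Y ω).1 := by
    intro u hu
    by_contra hnot
    have := hω u
    rw [if_neg hnot, Nat.cast_zero, zero_div, measureReal_eq_zero_iff] at this
    exact hu this
  refine ⟨⟨fun h hh u => ?_, ?_⟩, hsupp⟩
  · rw [← measureReal_eq_measureReal_iff, hω, hω]
    simp only [hG.smul_mem_coset_iff (Y ω) hh]
  · obtain ⟨c, hc⟩ := hG.exists_coset_eq (Y ω)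
    have hcY : c ∈ (Y ω).1 := by
      rw [hc, mem_leftCoset_iff, inv_mul_cancel]; exact Subgroup.one_mem _
    exact ⟨c, fun u hu => hG.div_mem_of_mem_coset _ (hsupp u hu) hcY⟩

lemma IsErasure.ae_mem {X : Ω → G} {Y : Ω → FiniteCoset G} (h : IsErasure X Y μ)
    (hX : Measurable X) (hY : Measurable Y) : ∀ᵐ ω ∂μ, X ω ∈ (Y ω).1 := by
  have h1 : ∀ᵐ y ∂(μ.map Y), ∀ᵐ x ∂(condDistrib X Y μ y), x ∈ y.1 := by
    rw [ae_map_iff hY.aemeasurable (Set.to_countable _).measurableSet]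
    filter_upwards [h.ae_isUniformOnCoset hG] with ω hω
    exact ae_iff_of_countable.2 hω.2
  have h2 : ∀ᵐ q ∂((μ.map Y) ⊗ₘ condDistrib X Y μ), q.2 ∈ q.1.1 :=
    Measure.ae_compProd_of_ae_ae (Set.to_countable _).measurableSet h1
  rw [compProd_map_condDistrib hX.aemeasurable] at h2
  exact ae_of_ae_map (hY.prodMk hX).aemeasurable h2

/-- Translation of the first component by `x`, where the coset allows it. -/
noncomputable def cosetTranslate (p : ℕ) {G : Type*} [CommGroup G] (x : G)
    (q : G × FiniteCoset G) : G × FiniteCoset G :=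
  open Classical in
  (if x ∈ primeTorsion p G (cosetLevel p q.2) then x * q.1 else q.1, q.2)

/-- The law of an erasure pair is invariant under `cosetTranslate`. -/
lemma IsErasure.map_cosetTranslate {X : Ω → G} {Y : Ω → FiniteCoset G} (h : IsErasure X Y μ)
    (hX : Measurable X) (hY : Measurable Y) (x : G) :
    (μ.map fun ω => (X ω, Y ω)).map (cosetTranslate p x) = μ.map fun ω => (X ω, Y ω) := by
  have hXY : Measurable fun ω => (X ω, Y ω) := hX.prodMk hY
  have hint : ∀ g s, μ.map (fun ω => (X ω, Y ω)) {(g, s)} =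
      ∫⁻ ω in Y ⁻¹' {s}, condDistrib X Y μ (Y ω) {g} ∂μ := fun g s => by
    rw [setLIntegral_preimage_condDistrib hY hX.aemeasurable (measurableSet_singleton g)
      (measurableSet_singleton s), Measure.map_apply hXY (measurableSet_singleton _)]
    congr 1; ext ω; simp [and_comm]
  have hshift : ∀ y s, y ∈ primeTorsion p G (cosetLevel p s) → ∀ g,
      μ.map (fun ω => (X ω, Y ω)) {(y * g, s)} = μ.map (fun ω => (X ω, Y ω)) {(g, s)} := by
    intro y s hy g
    rw [hint, hint]
    refine setLIntegral_congr_fun_ae (hY (measurableSet_singleton s)) ?_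
    filter_upwards [h.ae_isUniformOnCoset hG] with ω hω hs
    rw [Set.mem_preimage, Set.mem_singleton_iff] at hs
    exact hω.1.invariant y (by rw [hs]; exact hy) g
  refine Measure.ext_of_singleton fun ⟨g, s⟩ => ?_
  rw [Measure.map_apply .of_discrete (measurableSet_singleton _)]
  by_cases hx : x ∈ primeTorsion p G (cosetLevel p s)
  · rw [← hshift x⁻¹ s (Subgroup.inv_mem _ hx) g]
    congr 1; ext ⟨g', s'⟩
    simp only [cosetTranslate, Set.mem_preimage, Set.mem_singleton_iff, Prod.mk.injEq]
    constructor
    · rintro ⟨h1, rfl⟩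
      rw [if_pos hx] at h1
      exact ⟨eq_inv_mul_of_mul_eq h1, rfl⟩
    · rintro ⟨h1, rfl⟩
      rw [if_pos hx, h1, mul_inv_cancel_left]
      exact ⟨rfl, rfl⟩
  · congr 1; ext ⟨g', s'⟩
    simp only [cosetTranslate, Set.mem_preimage, Set.mem_singleton_iff, Prod.mk.injEq]
    constructor
    · rintro ⟨h1, rfl⟩; rw [if_neg hx] at h1; exact ⟨h1, rfl⟩
    · rintro ⟨h1, rfl⟩; rw [if_neg hx]; exact ⟨h1, rfl⟩

variable {X : ℕ → Ω → G} {Y : ℕ → Ω → FiniteCoset G}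

omit hG hp in
lemma measurable_polarVec (n i : ℕ) : Measurable fun x : ℕ → G => polarVec x n i := by
  induction n generalizing i with
  | zero => exact measurable_pi_apply i
  | succ n ih =>
    obtain ⟨c, j, hj, rfl | rfl⟩ := exists_even_or_odd n i
    · simp only [polarVec_even _ n c hj]
      exact (Measurable.of_discrete (f := fun q : G × G => q.1 * q.2)).comp ((ih _).prodMk (ih _))
    · simp only [polarVec_odd _ n c hj]; exact ih _

/-- The polarized side information as a function of the source sequence. -/
def sideInfoVec {G : Type*} [CommGroup G] (n i : ℕ) (w : ℕ → G × FiniteCoset G) :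
    (Fin i → G) × (ℕ → FiniteCoset G) :=
  (fun j => polarVec (fun t => (w t).1) n j, fun j => (w j).2)

omit hG hp in
lemma measurable_sideInfoVec (n i : ℕ) : Measurable (sideInfoVec (G := G) n i) := by
  refine Measurable.prodMk (measurable_pi_lambda _ fun j => ?_) (by fun_prop)
  exact (measurable_polarVec n j).comp (by fun_prop)

omit hG hp [Countable G] [StandardBorelSpace G] [MeasurableSpace G] [MeasurableSpace Ω] in
lemma polarSideInfo_eq (n i : ℕ) (ω : Ω) :
    polarSideInfo X Y n i ω = sideInfoVec n i fun j => (X j ω, Y j ω) := by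
  simp [polarSideInfo, sideInfoVec, polarTransform_apply]

omit hG hp [IsProbabilityMeasure μ] in
lemma IsErasureSource.measurable_polarTransform [IsFiniteMeasure μ] (hs : IsErasureSource X Y μ)
    (n i : ℕ) : Measurable (polarTransform X n i) := by
  rw [show polarTransform X n i = fun ω => polarVec (fun j => X j ω) n i from
    funext (polarTransform_apply X n i)]
  exact (measurable_polarVec n i).comp (measurable_pi_lambda _ hs.measurable_fst)

omit hG hp [IsProbabilityMeasure μ] in
lemma IsErasureSource.measurable_polarSideInfo [IsFiniteMeasure μ] (hs : IsErasureSource X Y μ)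
    (n i : ℕ) : Measurable (polarSideInfo X Y n i) :=
  (measurable_pi_lambda _ fun j : Fin i => hs.measurable_polarTransform n j).prodMk
    (measurable_pi_lambda _ hs.measurable_snd)

omit hG hp [IsProbabilityMeasure μ] [Countable G] in
lemma IsErasureSource.measurable_cosetLevel [IsFiniteMeasure μ] (hs : IsErasureSource X Y μ)
    (i : ℕ) : Measurable fun ω => cosetLevel p (Y i ω) :=
  (Measurable.of_discrete (f := cosetLevel p)).comp (hs.measurable_snd i)

/-- Simultaneous translations of the source symbols preserve the joint law. -/
lemma IsErasureSource.measure_translate (hs : IsErasureSource X Y μ) (x : ℕ → G)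
    {S : Set (ℕ → G × FiniteCoset G)} (hS : MeasurableSet S) :
    μ {ω | (fun j => cosetTranslate p (x j) (X j ω, Y j ω)) ∈ S} =
      μ {ω | (fun j => (X j ω, Y j ω)) ∈ S} := by
  have hm : ∀ i, Measurable fun ω => (X i ω, Y i ω) := fun i =>
    (hs.measurable_fst i).prodMk (hs.measurable_snd i)
  have hT : ∀ i, Measurable (cosetTranslate p (x i)) := fun i => .of_discrete
  have hlaw := hs.indep.map_fun_eq_infinitePi_map hm
  have : ∀ i, IsProbabilityMeasure (μ.map fun ω => (X i ω, Y i ω)) := fun i =>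
    Measure.isProbabilityMeasure_map (hm i).aemeasurable
  have hpi := Measure.infinitePi_map_pi (μ := fun i => μ.map fun ω => (X i ω, Y i ω)) hT
  rw [← hlaw, Measure.map_map (by fun_prop) (by fun_prop)] at hpi
  simp only [fun i => (hs.erasure i).map_cosetTranslate hG (hs.measurable_fst i)
    (hs.measurable_snd i) (x i)] at hpi
  rw [← hlaw] at hpi
  have := congrArg (fun ν => ν S) hpi
  rwa [Measure.map_apply (by fun_prop) hS, Measure.map_apply (by fun_prop) hS] at this

/-- Translating the source by a vector of allowed translations whose first `i` transformed entries
vanish shifts the conditional law of the `i`-th entry. -/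
lemma IsErasureSource.ae_condDistrib_translate (hs : IsErasureSource X Y μ) (n i : ℕ) {x : ℕ → G}
    (hx : ∀ j < i, polarVec x n j = 1) (u : G) :
    ∀ᵐ ω ∂μ, (∀ j, x j ∈ primeTorsion p G (cosetLevel p (Y j ω))) →
      condDistrib (polarTransform X n i) (polarSideInfo X Y n i) μ (polarSideInfo X Y n i ω)
          {polarVec x n i * u} =
        condDistrib (polarTransform X n i) (polarSideInfo X Y n i) μ (polarSideInfo X Y n i ω)
          {u} := by
  set U := polarTransform X n i with hU
  set Z := polarSideInfo X Y n i with hZ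
  have hUeq : ∀ ω, U ω = polarVec (fun t => X t ω) n i := polarTransform_apply X n i
  have hZeq : ∀ ω, Z ω = sideInfoVec n i fun j => (X j ω, Y j ω) := polarSideInfo_eq n i
  have hZm : Measurable Z := hs.measurable_polarSideInfo n i
  have hfst : Measurable fun w : ℕ → G × FiniteCoset G => fun t => (w t).1 := by fun_prop
  have hUm : Measurable U := hs.measurable_polarTransform n i
  let D : Set ((Fin i → G) × (ℕ → FiniteCoset G)) :=
    {z | ∀ j, x j ∈ primeTorsion p G (cosetLevel p (z.2 j))}
  have hD : MeasurableSet D := by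
    have : D = ⋂ j, (fun z : (Fin i → G) × (ℕ → FiniteCoset G) => z.2 j) ⁻¹'
        {s | x j ∈ primeTorsion p G (cosetLevel p s)} := by ext; simp [D]
    rw [this]
    exact MeasurableSet.iInter fun j => ((measurable_pi_apply j).comp _root_.measurable_snd) trivial
  suffices h : ∀ᵐ z ∂(μ.map Z).restrict D,
      condDistrib U Z μ z {polarVec x n i * u} = condDistrib U Z μ z {u} by
    rw [ae_restrict_iff' hD] at h
    exact ae_of_ae_map hZm.aemeasurable h
  refine ae_eq_of_forall_setLIntegral_eq_of_sigmaFinite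
    (Kernel.measurable_coe _ (measurableSet_singleton _))
    (Kernel.measurable_coe _ (measurableSet_singleton _)) fun B hB _ => ?_
  have hBD := hB.inter hD
  have hint : ∀ g, ∫⁻ z in B, condDistrib U Z μ z {g} ∂(μ.map Z).restrict D =
      μ {ω | (fun j => (X j ω, Y j ω)) ∈
        {w | sideInfoVec n i w ∈ B ∩ D ∧ polarVec (fun t => (w t).1) n i = g}} := by
    intro g
    rw [Measure.restrict_restrict hB, setLIntegral_map hBD
      (Kernel.measurable_coe _ (measurableSet_singleton _)) hZm,
      setLIntegral_preimage_condDistrib hZm hUm.aemeasurable (measurableSet_singleton g) hBD]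
    congr 1; ext ω
    simp only [Set.mem_inter_iff, Set.mem_preimage, Set.mem_singleton_iff, Set.mem_ofPred_eq, hUeq,
      hZeq]
  rw [hint, hint, ← hs.measure_translate hG x]
  · congr 1; ext ω
    -- on the event `D` the translation multiplies the transform by that of `x`
    have htr : sideInfoVec n i (fun j => (X j ω, Y j ω)) ∈ D → ∀ s,
        polarVec (fun t => (cosetTranslate p (x t) (X t ω, Y t ω)).1) n s =
          polarVec x n s * polarVec (fun t => X t ω) n s := by
      intro hDω s
      rw [← polarVec_mul]
      congr 1; ext t
      simp only [cosetTranslate, Pi.mul_apply]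
      exact if_pos (hDω t)
    have hside : sideInfoVec n i (fun j => (X j ω, Y j ω)) ∈ D →
        sideInfoVec n i (fun j => cosetTranslate p (x j) (X j ω, Y j ω)) =
          sideInfoVec n i (fun j => (X j ω, Y j ω)) := by
      intro hDω
      refine Prod.ext (funext fun s => ?_) rfl
      change polarVec (fun t => (cosetTranslate p (x t) (X t ω, Y t ω)).1) n s = _
      rw [htr hDω, hx s s.2, one_mul]
      rfl
    have hDiff : sideInfoVec n i (fun j => cosetTranslate p (x j) (X j ω, Y j ω)) ∈ D ↔
        sideInfoVec n i (fun j => (X j ω, Y j ω)) ∈ D := Iff.rfl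
    simp only [Set.mem_ofPred_eq, Set.mem_inter_iff]
    constructor
    · rintro ⟨⟨h1, h2⟩, h3⟩
      have h2' := hDiff.1 h2
      rw [htr h2', mul_right_inj] at h3
      rw [hside h2'] at h1
      exact ⟨⟨h1, h2'⟩, h3⟩
    · rintro ⟨⟨h1, h2⟩, h3⟩
      rw [htr h2, hside h2, h3]
      exact ⟨⟨h1, h2⟩, rfl⟩
  · exact (measurable_sideInfoVec n i hBD).inter
      (((measurable_polarVec n i).comp hfst) (measurableSet_singleton _))

end Source

section Source

variable {p : ℕ} [hp : Fact p.Prime] {G : Type u} [CommGroup G] [Countable G]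
  [MeasurableSpace G] [StandardBorelSpace G]
  {Ω : Type v} [MeasurableSpace Ω] {μ : Measure Ω} [IsProbabilityMeasure μ]
  {X : ℕ → Ω → G} {Y : ℕ → Ω → FiniteCoset G}
  (hG : IsPruferGroup p G)
include hG

omit [Countable G] [MeasurableSpace G] [StandardBorelSpace G] in
/-- The transform of a vector with `x j ∈ y j` is determined, up to the subgroup given by
`polarLevel`, by its earlier entries. -/
lemma IsPruferGroup.polarVec_div_mem {x x' : ℕ → G} {y : ℕ → FiniteCoset G} {n c r : ℕ}
    (hr : r < 2 ^ n) (hx : ∀ t < 2 ^ n, x (2 ^ n * c + t) ∈ (y (2 ^ n * c + t)).1)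
    (hx' : ∀ t < 2 ^ n, x' (2 ^ n * c + t) ∈ (y (2 ^ n * c + t)).1)
    (h : ∀ s < r, polarVec x n (2 ^ n * c + s) = polarVec x' n (2 ^ n * c + s)) :
    polarVec x n (2 ^ n * c + r) / polarVec x' n (2 ^ n * c + r) ∈
      primeTorsion p G (polarLevel (fun j => cosetLevel p (y j)) n (2 ^ n * c + r)) := by
  rw [← polarVec_div]
  refine polarVec_mem (fun t ht => hG.div_mem_of_mem_coset _ (hx t ht) (hx' t ht)) hr
    fun s hs => ?_
  rw [polarVec_div, h s hs, div_self']

/-- **The conditional distribution of a polarized symbol.** Given its side information, it is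
uniform on a coset of the subgroup whose level is computed from the source levels by `polarLevel`.
-/
theorem IsErasureSource.ae_isUniformOnCoset_polar (hs : IsErasureSource X Y μ) (n i : ℕ) :
    ∀ᵐ ω ∂μ, IsUniformOnCoset
      (condDistrib (polarTransform X n i) (polarSideInfo X Y n i) μ (polarSideInfo X Y n i ω))
      (primeTorsion p G (polarLevel (fun j => cosetLevel p (Y j ω)) n i)) := by
  classical
  set U := polarTransform X n i with hU
  set Z := polarSideInfo X Y n i with hZ
  have hUm : Measurable U := hs.measurable_polarTransform n i
  have hZm : Measurable Z := hs.measurable_polarSideInfo n i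
  obtain ⟨c, r, hr, rfl⟩ : ∃ c r, r < 2 ^ n ∧ i = 2 ^ n * c + r :=
    ⟨i / 2 ^ n, i % 2 ^ n, Nat.mod_lt _ (by positivity), (Nat.div_add_mod _ _).symm⟩
  set M := 2 ^ n * (c + 1) with hM
  have hMblock : ∀ t < 2 ^ n, 2 ^ n * c + t < M := fun t ht => by rw [hM, mul_add]; omega
  -- invariance: only the countably many translations supported on the first blocks are needed
  have hinv : ∀ᵐ ω ∂μ, ∀ h ∈ primeTorsion p G
      (polarLevel (fun j => cosetLevel p (Y j ω)) n (2 ^ n * c + r)), ∀ u,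
        condDistrib U Z μ (Z ω) {h * u} = condDistrib U Z μ (Z ω) {u} := by
    let extend : (Fin M → G) → ℕ → G := fun v j => if h : j < M then v ⟨j, h⟩ else 1
    have hall : ∀ᵐ ω ∂μ, ∀ (v : Fin M → G) (u : G),
        (∀ j < 2 ^ n * c + r, polarVec (extend v) n j = 1) →
        (∀ j, extend v j ∈ primeTorsion p G (cosetLevel p (Y j ω))) →
        condDistrib U Z μ (Z ω) {polarVec (extend v) n (2 ^ n * c + r) * u} =
          condDistrib U Z μ (Z ω) {u} := by
      refine ae_all_iff.2 fun v => ae_all_iff.2 fun u => ?_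
      by_cases hv : ∀ j < 2 ^ n * c + r, polarVec (extend v) n j = 1
      · filter_upwards [hs.ae_condDistrib_translate hG n (2 ^ n * c + r) hv u] with ω hω _
        exact hω
      · exact Eventually.of_forall fun ω hv' => absurd hv' hv
    filter_upwards [hall] with ω hω h hh u
    obtain ⟨x, hx1, hx2, hx3, hx4⟩ := exists_polarVec_eq _ hr hh
    have hext : extend (fun j => x j) = x := by
      ext j
      by_cases hj : j < M
      · simp [extend, hj]
      · have hd : j / 2 ^ n ≠ c := fun hd => hj <| by
          rw [← Nat.div_add_mod j (2 ^ n), hd]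
          exact hMblock _ (Nat.mod_lt _ (by positivity))
        have := hx2 _ hd (j % 2 ^ n) (Nat.mod_lt _ (by positivity))
        rw [Nat.div_add_mod] at this
        simp [extend, hj, this]
    have := hω (fun j => x j) u
    rw [hext, hx4] at this
    refine this (fun j hj => ?_) hx1
    by_cases hd : j / 2 ^ n = c
    · have := hx3 (j % 2 ^ n) (by
        have := Nat.div_add_mod j (2 ^ n); rw [hd] at this; omega)
      rwa [← hd, Nat.div_add_mod] at this
    · have := polarVec_eq_one_of_ne (Nat.mod_lt j (show 0 < 2 ^ n by positivity)) hd hx2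
      rwa [Nat.div_add_mod] at this
  -- support: a representative of the coset is a function of countably many values
  have hsupp : ∀ᵐ ω ∂μ, ∃ g, ∀ u, condDistrib U Z μ (Z ω) {u} ≠ 0 → u / g ∈ primeTorsion p G
      (polarLevel (fun j => cosetLevel p (Y j ω)) n (2 ^ n * c + r)) := by
    let fits : (Fin (2 ^ n * c + r) → G) × (Fin M → FiniteCoset G) → (ℕ → G) → Prop := fun q x =>
      (∀ j : Fin M, x j ∈ (q.2 j).1) ∧ ∀ s : Fin (2 ^ n * c + r), polarVec x n s = q.1 s
    let rep : (Fin (2 ^ n * c + r) → G) × (Fin M → FiniteCoset G) → G := fun q =>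
      if h : ∃ x, fits q x then polarVec h.choose n (2 ^ n * c + r) else 1
    let trunc : (Fin (2 ^ n * c + r) → G) × (ℕ → FiniteCoset G) →
        (Fin (2 ^ n * c + r) → G) × (Fin M → FiniteCoset G) := fun z => (z.1, fun j => z.2 j)
    have htrunc : Measurable trunc := by fun_prop
    let S : Set (((Fin (2 ^ n * c + r) → G) × (ℕ → FiniteCoset G)) × G) :=
      {q | q.2 / rep (trunc q.1) ∈ primeTorsion p G
        (polarLevel (fun j => cosetLevel p (q.1.2 j)) n (2 ^ n * c + r))}
    have hS : MeasurableSet S := by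
      have hmap : Measurable fun q : ((Fin (2 ^ n * c + r) → G) × (ℕ → FiniteCoset G)) × G =>
          (q.2, rep (trunc q.1),
            polarLevel (fun j => cosetLevel p (q.1.2 j)) n (2 ^ n * c + r)) :=
        _root_.measurable_snd.prodMk
          (((Measurable.of_discrete (f := rep)).comp (htrunc.comp _root_.measurable_fst)).prodMk
            (measurable_polarLevel (fun j => (Measurable.of_discrete (f := cosetLevel p)).comp
              ((measurable_pi_apply j).comp
                (_root_.measurable_snd.comp _root_.measurable_fst))) n _))
      exact hmap (t := {t : G × G × ℕ | t.1 / t.2.1 ∈ primeTorsion p G t.2.2})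
        (Set.to_countable _).measurableSet
    have hmem : ∀ᵐ ω ∂μ, (Z ω, U ω) ∈ S := by
      filter_upwards [ae_all_iff.2 fun j =>
        (hs.erasure j).ae_mem hG (hs.measurable_fst j) (hs.measurable_snd j)] with ω hω
      have hfits : fits (trunc (Z ω)) (fun j => X j ω) :=
        ⟨fun j => hω j, fun s => (polarTransform_apply X n s ω).symm⟩
      have hex : ∃ x, fits (trunc (Z ω)) x := ⟨fun j => X j ω, hfits⟩
      have hch := hex.choose_spec
      change U ω / rep (trunc (Z ω)) ∈ primeTorsion p G
        (polarLevel (fun j => cosetLevel p (Y j ω)) n (2 ^ n * c + r))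
      rw [show rep (trunc (Z ω)) = polarVec hex.choose n (2 ^ n * c + r) from dif_pos hex,
        show U ω = _ from polarTransform_apply X n _ ω]
      refine hG.polarVec_div_mem hr (fun t _ => hω _)
        (fun t ht => hch.1 ⟨_, hMblock t ht⟩) fun s hs => ?_
      have h1 := hfits.2 ⟨2 ^ n * c + s, by omega⟩
      have h2 := hch.2 ⟨2 ^ n * c + s, by omega⟩
      exact h1.trans h2.symm
    have h1 : ∀ᵐ q ∂((μ.map Z) ⊗ₘ condDistrib U Z μ), q ∈ S := by
      rw [compProd_map_condDistrib hUm.aemeasurable]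
      exact (ae_map_iff (hZm.prodMk hUm).aemeasurable hS).2 hmem
    filter_upwards [ae_of_ae_map hZm.aemeasurable (Measure.ae_ae_of_ae_compProd h1)] with ω hω
    exact ⟨rep (trunc (Z ω)), ae_iff_of_countable.1 hω⟩
  filter_upwards [hinv, hsupp] with ω h1 h2
  exact ⟨h1, h2⟩

/-! ### The entropies in terms of the levels -/

omit hG hp [Countable G] [StandardBorelSpace G] [MeasurableSpace G] [IsProbabilityMeasure μ]
  [CommGroup G] in
/-- The mean of `(L - k)⁺` as a sum of tail probabilities. -/
lemma lintegral_ofReal_log_pow {L : Ω → ℕ} (hL : Measurable L) (k : ℕ) :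
    ∫⁻ ω, ENNReal.ofReal (Real.log ((p ^ (L ω - k) : ℕ) : ℝ)) ∂μ =
      ENNReal.ofReal (Real.log p) * ∑' j, μ {ω | j + k < L ω} := by
  have hlog : 0 ≤ Real.log p := Real.log_natCast_nonneg p
  have hset : ∀ j, MeasurableSet {ω | j + k < L ω} := fun j => hL (t := {t | j + k < t}) trivial
  have h1 : ∀ ω, ENNReal.ofReal (Real.log ((p ^ (L ω - k) : ℕ) : ℝ)) =
      ENNReal.ofReal (Real.log p) * ∑' j, Set.indicator {ω | j + k < L ω} (1 : Ω → ℝ≥0∞) ω := by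
    intro ω
    rw [tsum_eq_sum (s := Finset.range (L ω - k)) fun j hj => ?_]
    · rw [Nat.cast_pow, Real.log_pow, ENNReal.ofReal_mul (by positivity), ENNReal.ofReal_natCast,
        mul_comm]
      congr 1
      rw [Finset.sum_congr rfl (g := fun _ => (1 : ℝ≥0∞)) fun j hj => ?_]
      · simp
      · rw [Finset.mem_range] at hj
        exact Set.indicator_of_mem (s := {ω | j + k < L ω}) (show j + k < L ω by omega) _
    · rw [Finset.mem_range] at hj
      exact Set.indicator_of_notMem (s := {ω | j + k < L ω}) (show ¬ j + k < L ω by omega) _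
  simp only [h1]
  rw [lintegral_const_mul' _ _ ENNReal.ofReal_ne_top, lintegral_tsum fun j =>
    (measurable_one.indicator (hset j)).aemeasurable]
  simp only [lintegral_indicator_one (hset _)]

/-- The probability that the level of the `i`-th source symbol exceeds `k`. -/
noncomputable def sourceTail (p : ℕ) (Y : ℕ → Ω → FiniteCoset G) (μ : Measure Ω) (i k : ℕ) : ℝ :=
  μ.real {ω | k < cosetLevel p (Y i ω)}

lemma IsErasureSource.condEntropy_eq (hs : IsErasureSource X Y μ) (i : ℕ) :
    condEntropy (X i) (Y i) μ =
      ENNReal.ofReal (Real.log p) * ∑' k, ENNReal.ofReal (sourceTail p Y μ i k) := by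
  have h1 := lintegral_ofReal_log_pow (p := p) (μ := μ)
    (L := fun ω => cosetLevel p (Y i ω)) (hs.measurable_cosetLevel i) 0
  simp only [Nat.sub_zero, add_zero] at h1
  simp only [sourceTail, fun k => ofReal_measureReal (μ := μ)
    (s := {ω | k < cosetLevel p (Y i ω)}) (measure_ne_top _ _)]
  rw [← h1]
  refine lintegral_congr_ae ?_
  filter_upwards [(hs.erasure i).ae_isUniformOnCoset hG] with ω hω
  have := hG.finite_primeTorsion (cosetLevel p (Y i ω))
  rw [hω.1.tsum_negMulLog, hG.card_primeTorsion]

end Source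

/-- Polarized levels from different blocks are independent. -/
lemma indepFun_polarLevel {Ω : Type*} [MeasurableSpace Ω] {μ : Measure Ω} {l : ℕ → Ω → ℕ}
    (hl : ∀ i, Measurable (l i)) (hind : iIndepFun l μ) (n : ℕ) {a b r s : ℕ} (hab : a ≠ b)
    (hr : r < 2 ^ n) (hs : s < 2 ^ n) :
    IndepFun (fun ω => polarLevel (fun j => l j ω) n (2 ^ n * a + r))
      (fun ω => polarLevel (fun j => l j ω) n (2 ^ n * b + s)) μ := by
  classical
  let block : ℕ → Finset ℕ := fun c => (Finset.range (2 ^ n)).image fun t => 2 ^ n * c + t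
  have hmem : ∀ c t, t < 2 ^ n → 2 ^ n * c + t ∈ block c := fun c t ht =>
    Finset.mem_image_of_mem _ (Finset.mem_range.2 ht)
  have hdiv : ∀ c, ∀ i ∈ block c, i / 2 ^ n = c := by
    intro c i hi
    obtain ⟨t, ht, rfl⟩ := Finset.mem_image.1 hi
    rw [Nat.mul_add_div (by positivity), Nat.div_eq_of_lt (Finset.mem_range.1 ht), add_zero]
  have hdisj : Disjoint (block a) (block b) := Finset.disjoint_left.2 fun i hi hi' =>
    hab ((hdiv a i hi).symm.trans (hdiv b i hi'))
  let φ : (c : ℕ) → ℕ → (block c → ℕ) → ℕ := fun c i v =>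
    polarLevel (fun j => if h : j ∈ block c then v ⟨j, h⟩ else 0) n i
  have hφ : ∀ c t, t < 2 ^ n → ∀ ω, polarLevel (fun j => l j ω) n (2 ^ n * c + t) =
      φ c (2 ^ n * c + t) fun j => l j ω := fun c t ht ω =>
    polarRec_congr ht fun u hu => by simp [hmem c u hu]
  simp only [hφ a r hr, hφ b s hs]
  exact (hind.indepFun_finset (block a) (block b) hdisj hl).comp
    (φ := φ a (2 ^ n * a + r)) (ψ := φ b (2 ^ n * b + s)) .of_discrete .of_discrete

/-- The tail probabilities of the polarized levels follow the erasure recursion, because the two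
levels combined in each step are independent. -/
lemma measureReal_lt_polarLevel {Ω : Type*} [MeasurableSpace Ω] {μ : Measure Ω}
    [IsProbabilityMeasure μ] {l : ℕ → Ω → ℕ} (hl : ∀ i, Measurable (l i)) (hind : iIndepFun l μ)
    (n i : ℕ) :
    (fun k => μ.real {ω | k < polarLevel (fun j => l j ω) n i}) =
      polarTail (fun i k => μ.real {ω | k < l i ω}) n i := by
  induction n generalizing i with
  | zero => rfl
  | succ n ih =>
    obtain ⟨c, j, hj, hi⟩ := exists_even_or_odd n i
    have e1 : 2 ^ (n + 1) * c + j = 2 ^ n * (2 * c) + j := by ring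
    have e2 : 2 ^ (n + 1) * c + j + 2 ^ n = 2 ^ n * (2 * c + 1) + j := by ring
    set A : ℕ → Set Ω := fun k => {ω | k < polarLevel (fun j => l j ω) n (2 ^ n * (2 * c) + j)}
      with hA
    set B : ℕ → Set Ω := fun k => {ω | k < polarLevel (fun j => l j ω) n (2 ^ n * (2 * c + 1) + j)}
      with hB
    have hBm : ∀ k, MeasurableSet (B k) := fun k =>
      measurable_polarLevel hl n _ (t := {t | k < t}) trivial
    have hAB : ∀ k, μ.real (A k ∩ B k) = μ.real (A k) * μ.real (B k) := fun k => by
      have := (indepFun_polarLevel hl hind n (show 2 * c ≠ 2 * c + 1 by omega) hj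
        hj).measure_inter_preimage_eq_mul {t | k < t} {t | k < t} trivial trivial
      simpa [Measure.real, ENNReal.toReal_mul] using congrArg ENNReal.toReal this
    rcases hi with rfl | rfl
    · rw [polarTail_even _ n c hj, e2, e1, ← ih, ← ih]
      ext k
      have hset : {ω | k < polarLevel (fun j => l j ω) (n + 1) (2 ^ (n + 1) * c + 2 * j)} =
          A k ∪ B k := by
        ext ω; simp [hA, hB, polarLevel_even _ n c hj]
      have := measureReal_union_add_inter (μ := μ) (s := A k) (hBm k)
      rw [hset, maxTail, ← hAB k]
      linarith
    · rw [polarTail_odd _ n c hj, e2, e1, ← ih, ← ih]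
      ext k
      have hset : {ω | k < polarLevel (fun j => l j ω) (n + 1) (2 ^ (n + 1) * c + (2 * j + 1))} =
          A k ∩ B k := by
        ext ω; simp [hA, hB, polarLevel_odd _ n c hj]
      rw [hset, minTail, hAB k]

section Source

variable {p : ℕ} [hp : Fact p.Prime] {G : Type u} [CommGroup G] [Countable G]
  [MeasurableSpace G] [StandardBorelSpace G]
  {Ω : Type v} [MeasurableSpace Ω] {μ : Measure Ω} [IsProbabilityMeasure μ]
  {X : ℕ → Ω → G} {Y : ℕ → Ω → FiniteCoset G}
  (hG : IsPruferGroup p G)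
include hG

omit hG hp in
lemma IsErasureSource.measureReal_lt_polarLevel (hs : IsErasureSource X Y μ) (n i k : ℕ) :
    μ {ω | k < polarLevel (fun j => cosetLevel p (Y j ω)) n i} =
      ENNReal.ofReal (polarTail (sourceTail p Y μ) n i k) := by
  have hind : iIndepFun (fun i ω => cosetLevel p (Y i ω)) μ :=
    hs.indep.comp (fun _ q => cosetLevel p q.2) fun _ => .of_discrete
  have h := congrFun (_root_.measureReal_lt_polarLevel
    hs.measurable_cosetLevel hind n i) k
  rw [← ofReal_measureReal]
  exact congrArg ENNReal.ofReal h

lemma IsErasureSource.polarEntropy_eq (hs : IsErasureSource X Y μ) (n i : ℕ) :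
    polarEntropy X Y μ n i = ENNReal.ofReal (Real.log p) *
      ∑' k, ENNReal.ofReal (polarTail (sourceTail p Y μ) n i k) := by
  have h1 := lintegral_ofReal_log_pow (p := p) (μ := μ)
    (L := fun ω => polarLevel (fun j => cosetLevel p (Y j ω)) n i)
    (measurable_polarLevel hs.measurable_cosetLevel n i) 0
  simp only [Nat.sub_zero, add_zero, hs.measureReal_lt_polarLevel] at h1
  rw [← h1, polarEntropy, condEntropy]
  refine lintegral_congr_ae ?_
  filter_upwards [hs.ae_isUniformOnCoset_polar hG n i] with ω hω
  have := hG.finite_primeTorsion (polarLevel (fun j => cosetLevel p (Y j ω)) n i)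
  rw [hω.tsum_negMulLog, hG.card_primeTorsion]

/-- Modulo the subgroup of order `p ^ k`, a level `L` leaves the level `L - k`. -/
lemma IsErasureSource.polarCosetEntropy_eq (hs : IsErasureSource X Y μ) (k n i : ℕ)
    [StandardBorelSpace (G ⧸ primeTorsion p G k)] :
    polarCosetEntropy (primeTorsion p G k) X Y μ n i = ENNReal.ofReal (Real.log p) *
      ∑' j, ENNReal.ofReal (polarTail (sourceTail p Y μ) n i (j + k)) := by
  have h1 := lintegral_ofReal_log_pow (p := p) (μ := μ)
    (L := fun ω => polarLevel (fun j => cosetLevel p (Y j ω)) n i)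
    (measurable_polarLevel hs.measurable_cosetLevel n i) k
  simp only [hs.measureReal_lt_polarLevel] at h1
  rw [← h1, polarCosetEntropy, condEntropy]
  refine lintegral_congr_ae ?_
  have hmk : Measurable (QuotientGroup.mk' (primeTorsion p G k)) := .of_discrete
  have hcomp := ae_of_ae_map (hs.measurable_polarSideInfo n i).aemeasurable
    (condDistrib_comp (μ := μ) (polarSideInfo X Y n i)
      (hs.measurable_polarTransform n i).aemeasurable hmk)
  filter_upwards [hs.ae_isUniformOnCoset_polar hG n i, hcomp] with ω hω hc
  have := hG.finite_primeTorsion (polarLevel (fun j => cosetLevel p (Y j ω)) n i)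
  have hfin : Finite ((primeTorsion p G (polarLevel (fun j => cosetLevel p (Y j ω)) n i)).map
    (QuotientGroup.mk' (primeTorsion p G k))) :=
      Set.Finite.to_subtype ((Set.toFinite _).image _)
  have hu := hω.map (QuotientGroup.mk' (primeTorsion p G k))
  have hprob := Measure.isProbabilityMeasure_map
    (μ := condDistrib (polarTransform X n i) (polarSideInfo X Y n i) μ (polarSideInfo X Y n i ω))
    hmk.aemeasurable
  have := hu.tsum_negMulLog
  rw [hG.card_map_mk] at this
  rw [← this]
  rw [Kernel.map_apply _ hmk] at hc
  rw [← hc]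
  rfl

end Source

/-! ### Polarization of erasure sources -/

section Source

variable {p : ℕ} [hp : Fact p.Prime] {G : Type u} [CommGroup G] [Countable G]
  [MeasurableSpace G] [StandardBorelSpace G]
  {Ω : Type v} [MeasurableSpace Ω] {μ : Measure Ω} [IsProbabilityMeasure μ]
  {X : ℕ → Ω → G} {Y : ℕ → Ω → FiniteCoset G}
  (hG : IsPruferGroup p G)
include hG

omit [Countable G] [StandardBorelSpace G] [MeasurableSpace G] in
lemma levelMass_sourceTail {i : ℕ} (hY : Measurable (Y i)) (k : ℕ) :
    levelMass (sourceTail p Y μ i) k = μ.real {ω | Y i ω ∈ cosetsOf (primeTorsion p G k)} := by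
  have hset : ∀ S : Set ℕ, MeasurableSet {ω | cosetLevel p (Y i ω) ∈ S} := fun S =>
    hY (t := {s | cosetLevel p s ∈ S}) trivial
  simp only [hG.mem_cosetsOf_iff, levelMass, sourceTail]
  have hunion : ∀ S T : Set ℕ, Disjoint S T →
      μ.real {ω | cosetLevel p (Y i ω) ∈ S} + μ.real {ω | cosetLevel p (Y i ω) ∈ T} =
        μ.real {ω | cosetLevel p (Y i ω) ∈ S ∪ T} := fun S T hST =>
    (measureReal_union (μ := μ) (s₁ := {ω | cosetLevel p (Y i ω) ∈ S})
      (s₂ := {ω | cosetLevel p (Y i ω) ∈ T}) (Set.disjoint_left.2 fun ω h1 h2 => Set.disjoint_left.1 hST h1 h2)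
      (hset T)).symm
  have h := hunion {k} {t | k < t} (by simp)
  rw [sub_eq_iff_eq_add]
  refine Eq.trans ?_ h.symm
  split_ifs with hk
  · rw [← probReal_univ (μ := μ)]
    congr 1; ext ω; simp [hk, Nat.eq_zero_or_pos]
  · congr 1; ext ω
    simp only [Set.mem_ofPred_eq, Set.mem_union, Set.mem_singleton_iff]
    omega

omit hG [Countable G] [StandardBorelSpace G] [MeasurableSpace G] hp in
lemma isTail_sourceTail {i : ℕ}
    (h : ∑' k, ENNReal.ofReal (sourceTail p Y μ i k) ≠ ∞) : IsTail (sourceTail p Y μ i) where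
  anti k l hkl := measureReal_mono fun ω (h : l < _) => lt_of_le_of_lt hkl h
  nonneg _ := measureReal_nonneg
  le_one _ := measureReal_le_one
  summable := by
    have := ENNReal.summable_toReal h
    exact this.congr fun k => ENNReal.toReal_ofReal measureReal_nonneg

omit hG [Countable G] [StandardBorelSpace G] [MeasurableSpace G] hp [CommGroup G]
  [MeasurableSpace Ω] [IsProbabilityMeasure μ] in
lemma ofReal_mul_tsum_ofReal {a : ℕ → ℝ} (ha : IsTail a) {c : ℝ} (hc : 0 ≤ c) :
    ENNReal.ofReal c * ∑' k, ENNReal.ofReal (a k) = ENNReal.ofReal (c * ∑' k, a k) := by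
  rw [← ENNReal.ofReal_tsum_of_nonneg ha.nonneg ha.summable, ENNReal.ofReal_mul hc]

/-- A finite entropy rate makes all levels integrable, with bounded average means. -/
lemma IsErasureSource.exists_bound (hs : IsErasureSource X Y μ)
    (hrate : upperEntropyRate X Y μ < ∞) :
    (∀ i, IsTail (sourceTail p Y μ i)) ∧ ∃ C : ℝ, ∀ᶠ m : ℕ in atTop,
      ∑ i ∈ Finset.range m, ∑' j, sourceTail p Y μ i j ≤ C * m := by
  have hlog : 0 < Real.log p := Real.log_pos (by exact_mod_cast hp.out.one_lt)
  obtain ⟨C, hC1, hC2⟩ := exists_between hrate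
  have hev := eventually_lt_of_limsup_lt hC1
  have hev' : ∀ᶠ m : ℕ in atTop,
      ∑ i ∈ Finset.range m, condEntropy (X i) (Y i) μ ≤ C * m := by
    filter_upwards [hev, eventually_gt_atTop 0] with m hm hm0
    have hm0' : (m : ℝ≥0∞) ≠ 0 := by exact_mod_cast hm0.ne'
    exact (ENNReal.div_le_iff hm0' (ENNReal.natCast_ne_top m)).1 hm.le
  have hfin : ∀ i, condEntropy (X i) (Y i) μ ≠ ∞ := by
    intro i
    obtain ⟨m, hm, him⟩ := (hev'.and (eventually_gt_atTop i)).exists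
    refine ne_top_of_le_ne_top (ENNReal.mul_ne_top hC2.ne (ENNReal.natCast_ne_top m))
      (le_trans ?_ hm)
    exact Finset.single_le_sum (f := fun i => condEntropy (X i) (Y i) μ) (fun _ _ => zero_le)
      (Finset.mem_range.2 him)
  have htail : ∀ i, IsTail (sourceTail p Y μ i) := by
    intro i
    refine isTail_sourceTail fun htop => hfin i ?_
    rw [hs.condEntropy_eq hG, htop]
    exact ENNReal.mul_top (by simpa using hlog)
  refine ⟨htail, C.toReal / Real.log p, hev'.mono fun m hm => ?_⟩
  simp only [hs.condEntropy_eq hG, ofReal_mul_tsum_ofReal (htail _) hlog.le] at hm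
  rw [← ENNReal.ofReal_sum_of_nonneg fun i _ => mul_nonneg hlog.le (htail i).tsum_nonneg,
    ← ENNReal.ofReal_toReal hC2.ne, ← ENNReal.ofReal_natCast,
    ← ENNReal.ofReal_mul ENNReal.toReal_nonneg, ENNReal.ofReal_le_ofReal_iff (by positivity),
    ← Finset.mul_sum] at hm
  rw [div_mul_eq_mul_div, le_div_iff₀ hlog, mul_comm]
  exact hm

open Classical in
lemma IsErasureSource.polarizedFraction_eq (hs : IsErasureSource X Y μ)
    (hx : ∀ i, IsTail (sourceTail p Y μ i)) (k : ℕ)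
    [StandardBorelSpace (G ⧸ primeTorsion p G k)] {δ : ℝ} (hδ : 0 < δ) (n m : ℕ) :
    polarizedFraction (primeTorsion p G k) X Y μ δ n m =
      (1 / ((m : ℝ) * 2 ^ n)) * (((Finset.range (m * 2 ^ n)).filter fun i =>
        IsPolarizedTo (polarTail (sourceTail p Y μ) n i) k (δ / Real.log p)).card : ℝ) := by
  have hlog : 0 < Real.log p := Real.log_pos (by exact_mod_cast hp.out.one_lt)
  unfold polarizedFraction
  congr 3
  refine Finset.filter_congr fun i _ => ?_
  have ht := isTail_polarTail hx n i
  rw [hs.polarCosetEntropy_eq hG, hs.polarEntropy_eq hG, ofReal_mul_tsum_ofReal ht hlog.le,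
    ofReal_mul_tsum_ofReal (ht.shift k) hlog.le, ENNReal.ofReal_lt_ofReal_iff hδ,
    ENNReal.toReal_ofReal (mul_nonneg hlog.le ht.tsum_nonneg), hG.card_primeTorsion, Nat.cast_pow,
    Real.log_pow, mul_comm (k : ℝ), ← mul_sub, abs_mul, abs_of_pos hlog, IsPolarizedTo,
    lt_div_iff₀' hlog, lt_div_iff₀' hlog]
  simp

/-- The asymptotic fraction of indices polarized to a level is the frequency of that level in the
source. -/
theorem IsErasureSource.tendsto_polarizedFraction (hs : IsErasureSource X Y μ)
    {Q : Subgroup G → ℝ} (hQ : HasCosetFrequencies Y μ Q) (hrate : upperEntropyRate X Y μ < ∞)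
    (k : ℕ) [StandardBorelSpace (G ⧸ primeTorsion p G k)] {δ : ℝ} (hδ : 0 < δ)
    (hδp : δ < Real.log p) :
    Tendsto (fun n => liminf (fun m => polarizedFraction (primeTorsion p G k) X Y μ δ n m) atTop)
      atTop (𝓝 (Q (primeTorsion p G k))) ∧
    Tendsto (fun n => limsup (fun m => polarizedFraction (primeTorsion p G k) X Y μ δ n m) atTop)
      atTop (𝓝 (Q (primeTorsion p G k))) ∧
    ((∀ i, IdentDistrib (fun ω => (X i ω, Y i ω)) (fun ω => (X 0 ω, Y 0 ω)) μ μ) →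
      ∃ l : ℕ → ℝ,
        (∀ n, Tendsto (fun m => polarizedFraction (primeTorsion p G k) X Y μ δ n m) atTop
          (𝓝 (l n))) ∧
        Tendsto l atTop (𝓝 (Q (primeTorsion p G k)))) := by
  have hlog : 0 < Real.log p := Real.log_pos (by exact_mod_cast hp.out.one_lt)
  obtain ⟨hx, C, hC⟩ := hs.exists_bound hG hrate
  have hfreq := hQ (primeTorsion p G k) inferInstance (hG.finite_primeTorsion k)
  simp only [← levelMass_sourceTail hG (hs.measurable_snd _)] at hfreq
  have hmain := tendsto_liminf_limsup_of_eventually fun ε hε =>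
    eventually_abs_fraction_sub_le hx hC hfreq (div_pos hδ hlog)
      ((div_lt_one hlog).2 hδp) hε
  simp only [hs.polarizedFraction_eq hG hx k hδ]
  refine ⟨hmain.1, hmain.2, fun hid => ?_⟩
  have hconst : ∀ i j, sourceTail p Y μ i = sourceTail p Y μ j := by
    have h0 : ∀ i, sourceTail p Y μ i = sourceTail p Y μ 0 := fun i => by
      ext k
      exact congrArg ENNReal.toReal ((hid i).measure_mem_eq
        (s := {q | k < cosetLevel p q.2}) (Set.to_countable _).measurableSet)
    exact fun i j => (h0 i).trans (h0 j).symm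
  have hlim := tendsto_fraction_of_constant hconst (fun a => IsPolarizedTo a k (δ / Real.log p))
  refine ⟨_, hlim, hmain.1.congr fun n => (hlim n).liminf_eq⟩

end Source

/-! ### A source with all levels -/

/-- A finite subgroup as a coset of itself. -/
def FiniteCoset.ofSubgroup {G : Type*} [CommGroup G] (N : Subgroup G) (hN : Finite N) :
    FiniteCoset G :=
  ⟨N, N, inferInstance, hN, 1, (one_smul G (N : Set G)).symm⟩

lemma FiniteCoset.nonempty {G : Type*} [Group G] (S : FiniteCoset G) : S.1.Nonempty := by
  obtain ⟨S, H, _, hfin, g, rfl⟩ := S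
  exact ⟨g • 1, Set.smul_mem_smul_set H.one_mem⟩

/-- The kernel choosing a uniform element of a finite coset. -/
noncomputable def cosetUniform (G : Type*) [CommGroup G] [Countable G] [MeasurableSpace G]
    [MeasurableSingletonClass G] : Kernel (FiniteCoset G) G where
  toFun S := uniformOn S.1
  measurable' := .of_discrete

instance {G : Type*} [CommGroup G] [Countable G] [MeasurableSpace G]
    [MeasurableSingletonClass G] : IsMarkovKernel (cosetUniform G) :=
  ⟨fun S => isProbabilityMeasure_uniformOn S.finite S.nonempty⟩

lemma cosetUniform_real {G : Type*} [CommGroup G] [Countable G] [MeasurableSpace G]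
    [MeasurableSingletonClass G] (S : FiniteCoset G) (B : Set G) :
    (cosetUniform G S).real B = ((B ∩ S.1).ncard : ℝ) / (S.1.ncard : ℝ) := by
  change (uniformOn S.1).real B = _
  rw [Measure.real, uniformOn, cond_apply (Set.to_countable _).measurableSet, Set.inter_comm,
    ENNReal.toReal_mul, ENNReal.toReal_inv, Measure.count_apply_finite _ S.finite,
    Measure.count_apply_finite _ (S.finite.subset Set.inter_subset_right),
    ENNReal.toReal_natCast, ENNReal.toReal_natCast, Set.ncard_eq_toFinset_card _ S.finite,
    Set.ncard_eq_toFinset_card _ (S.finite.subset Set.inter_subset_right), inv_mul_eq_div]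

/-- For every law `ν` of the side information there is a stationary erasure source. -/
lemma exists_isErasureSource {G : Type u} [CommGroup G] [Countable G] [MeasurableSpace G]
    [StandardBorelSpace G] (ν : Measure (FiniteCoset G)) [IsProbabilityMeasure ν] :
    ∃ (Ω : Type u) (_ : MeasurableSpace Ω) (μ : Measure Ω) (_ : IsProbabilityMeasure μ)
      (X : ℕ → Ω → G) (Y : ℕ → Ω → FiniteCoset G),
      IsErasureSource X Y μ ∧ ∀ i, μ.map (Y i) = ν := by
  let P : Measure (FiniteCoset G × G) := ν ⊗ₘ cosetUniform G
  let μ : Measure (ℕ → FiniteCoset G × G) := Measure.infinitePi fun _ => P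
  let X : ℕ → (ℕ → FiniteCoset G × G) → G := fun i ω => (ω i).2
  let Y : ℕ → (ℕ → FiniteCoset G × G) → FiniteCoset G := fun i ω => (ω i).1
  have hX : ∀ i, Measurable (X i) := fun i => by fun_prop
  have hY : ∀ i, Measurable (Y i) := fun i => by fun_prop
  have heval : ∀ i, μ.map (fun ω => (Y i ω, X i ω)) = P := fun i =>
    Measure.infinitePi_map_eval (fun _ => P) i
  have hlaw : ∀ i, μ.map (Y i) = ν := fun i => by
    rw [← Measure.fst_map_prodMk (hX i), heval i, Measure.fst_compProd]
  refine ⟨ℕ → FiniteCoset G × G, inferInstance, μ, inferInstance, X, Y, ⟨hX, hY, ?_, ?_⟩, hlaw⟩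
  · exact iIndepFun_infinitePi (P := fun _ => P) (X := fun _ q => q.swap) fun _ => measurable_swap
  · intro i B _
    have h := condDistrib_ae_eq_of_measure_eq_compProd (Y i) (hX i).aemeasurable
      (κ := cosetUniform G) (μ := μ) (by rw [hlaw i]; exact heval i)
    filter_upwards [ae_of_ae_map (hY i).aemeasurable h] with ω hω
    rw [hω, cosetUniform_real]

section Example

variable {p : ℕ} [hp : Fact p.Prime] {G : Type u} [CommGroup G] [Countable G]
  [MeasurableSpace G] [StandardBorelSpace G]

/-- The law of the subgroup of order `p ^ k`, with `k` geometrically distributed. -/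
noncomputable def geometricCoset (hG : IsPruferGroup p G) : Measure (FiniteCoset G) :=
  Measure.sum fun k : ℕ => ENNReal.ofReal (1 / 2 / 2 ^ k) •
    Measure.dirac (FiniteCoset.ofSubgroup (primeTorsion p G k) (hG.finite_primeTorsion k))

omit [Countable G] [MeasurableSpace G] [StandardBorelSpace G] in
lemma cosetLevel_ofSubgroup (hG : IsPruferGroup p G) (k : ℕ) :
    cosetLevel p (FiniteCoset.ofSubgroup (primeTorsion p G k) (hG.finite_primeTorsion k)) = k :=
  (hG.mem_cosetsOf_iff _ k).1 ⟨1, (one_smul G _).symm⟩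

omit [Countable G] [MeasurableSpace G] [StandardBorelSpace G] in
lemma isProbabilityMeasure_geometricCoset (hG : IsPruferGroup p G) :
    IsProbabilityMeasure (geometricCoset hG) := by
  constructor
  rw [geometricCoset, Measure.sum_apply _ .univ]
  simp only [Measure.smul_apply, measure_univ, smul_eq_mul, mul_one]
  rw [← ENNReal.ofReal_tsum_of_nonneg (fun k => by positivity) (summable_geometric_two' 1),
    tsum_geometric_two', ENNReal.ofReal_one]

/-- There is a source whose side information has every finite subgroup as its level with positive
probability. -/
theorem exists_source_all_levels (hG : IsPruferGroup p G) :
    ∃ (Ω : Type u) (_ : MeasurableSpace Ω) (μ : Measure Ω) (_ : IsProbabilityMeasure μ)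
      (X : ℕ → Ω → G) (Y : ℕ → Ω → FiniteCoset G) (Q : Subgroup G → ℝ),
      IsErasureSource X Y μ ∧ HasCosetFrequencies Y μ Q ∧ upperEntropyRate X Y μ < ∞ ∧
      ∀ N : Subgroup G, N.Normal → Finite N → 0 < Q N := by
  have := isProbabilityMeasure_geometricCoset hG
  obtain ⟨Ω, _, μ, _, X, Y, hs, hlaw⟩ := exists_isErasureSource (geometricCoset hG)
  have hmass : ∀ (S : Set (FiniteCoset G)) i, μ {ω | Y i ω ∈ S} = geometricCoset hG S :=
    fun S i => by
      rw [← hlaw i, Measure.map_apply (hs.measurable_snd i) trivial]; rfl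
  refine ⟨Ω, inferInstance, μ, inferInstance, X, Y, fun N => (geometricCoset hG).real (cosetsOf N),
    hs, ?_, ?_, ?_⟩
  · intro N _ _
    refine tendsto_const_nhds.congr' ?_
    filter_upwards [eventually_gt_atTop 0] with m hm
    have hm' : (m : ℝ) ≠ 0 := by exact_mod_cast hm.ne'
    simp only [Measure.real, hmass, Finset.sum_const, Finset.card_range, nsmul_eq_mul]
    rw [one_div, inv_mul_cancel_left₀ hm']
  · -- all entropies equal `E`, the mean of the logarithm of the size of the side information
    set E : ℝ≥0∞ := ∑' k : ℕ, ENNReal.ofReal (1 / 2 / 2 ^ k) *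
      ENNReal.ofReal (Real.log ((p ^ k : ℕ) : ℝ)) with hE
    have hEnt : ∀ i, condEntropy (X i) (Y i) μ = E := by
      intro i
      have h1 := lintegral_ofReal_log_pow (p := p) (μ := μ)
        (L := fun ω => cosetLevel p (Y i ω)) (hs.measurable_cosetLevel i) 0
      simp only [Nat.sub_zero, add_zero] at h1
      rw [hs.condEntropy_eq hG]
      simp only [sourceTail, fun k => ofReal_measureReal (μ := μ)
        (s := {ω | k < cosetLevel p (Y i ω)}) (measure_ne_top _ _)]
      rw [← h1, ← lintegral_map (μ := μ) (g := Y i)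
        (f := fun s => ENNReal.ofReal (Real.log ((p ^ cosetLevel p s : ℕ) : ℝ))) .of_discrete
        (hs.measurable_snd i), hlaw i, geometricCoset, lintegral_sum_measure]
      simp only [lintegral_smul_measure, lintegral_dirac, smul_eq_mul]
      exact tsum_congr fun k => by rw [cosetLevel_ofSubgroup hG]
    have hEfin : E < ∞ := by
      have hsum : Summable fun k : ℕ => (1 / 2 / 2 ^ k : ℝ) * Real.log ((p ^ k : ℕ) : ℝ) := by
        have := (summable_pow_mul_geometric_of_norm_lt_one 1
          (show ‖(1 / 2 : ℝ)‖ < 1 by norm_num)).mul_left (1 / 2 * Real.log p)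
        refine this.congr fun k => ?_
        rw [Nat.cast_pow, Real.log_pow, pow_one, one_div_pow]; ring
      have hnn : ∀ k : ℕ, (0 : ℝ) ≤ 1 / 2 / 2 ^ k := fun k => by positivity
      simp only [hE, ← ENNReal.ofReal_mul (hnn _)]
      exact hsum.tsum_ofReal_lt_top
    refine lt_of_le_of_lt ?_ hEfin
    refine limsup_le_of_le (by isBoundedDefault) (Eventually.of_forall fun m => ?_)
    simp only [hEnt, Finset.sum_const, Finset.card_range, nsmul_eq_mul]
    rw [mul_div_assoc]
    exact ENNReal.mul_div_le
  · intro N _ _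
    obtain ⟨k, rfl⟩ := hG.exists_eq_primeTorsion N
    refine ENNReal.toReal_pos (fun h0 => ?_) (measure_ne_top _ _)
    have h1 : (ENNReal.ofReal (1 / 2 / 2 ^ k) • Measure.dirac (FiniteCoset.ofSubgroup
        (primeTorsion p G k) (hG.finite_primeTorsion k))) (cosetsOf (primeTorsion p G k)) = 0 :=
      le_antisymm ((Measure.le_sum (fun k : ℕ => ENNReal.ofReal (1 / 2 / 2 ^ k) •
        Measure.dirac (FiniteCoset.ofSubgroup (primeTorsion p G k)
          (hG.finite_primeTorsion k))) k _).trans h0.le) zero_le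
    rw [Measure.smul_apply, Measure.dirac_apply' _ (MeasurableSet.of_discrete), Set.indicator_of_mem
      ((hG.mem_cosetsOf_iff _ k).2 (cosetLevel_ofSubgroup hG k)), Pi.one_apply, smul_eq_mul,
      mul_one, ENNReal.ofReal_eq_zero] at h1
    exact absurd h1 (not_le.2 (by positivity))

lemma IsPruferGroup.countable_finite_subgroups {p : ℕ} [Fact p.Prime] {G : Type*} [CommGroup G]
    (hG : IsPruferGroup p G) : {N : Subgroup G | N.Normal ∧ Finite N}.Countable :=
  (Set.countable_range (primeTorsion p G)).mono fun N hN => by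
    have := hN.2
    obtain ⟨k, rfl⟩ := hG.exists_eq_primeTorsion N
    exact ⟨k, rfl⟩

lemma IsPruferGroup.infinite_finite_subgroups {p : ℕ} [Fact p.Prime] {G : Type*} [CommGroup G]
    (hG : IsPruferGroup p G) : {N : Subgroup G | N.Normal ∧ Finite N}.Infinite :=
  Set.infinite_of_injective_forall_mem hG.primeTorsion_injective fun k =>
    ⟨inferInstance, hG.finite_primeTorsion k⟩

end Example

/-- Here `G` is the Prüfer `p`-group with a Polish group topology. `Countable G` follows from `e`;
it is listed only to make `G` and its quotients standard Borel by instance search. -/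
theorem corollary2 {p : ℕ} [Fact p.Prime]
    {G : Type u} [Group G] [Countable G] [TopologicalSpace G] [IsTopologicalGroup G] [PolishSpace G]
    [MeasurableSpace G] [BorelSpace G] (e : G ≃* Multiplicative (Prufer p)) :
    -- the subgroups form a chain
    (∀ H K : Subgroup G, H ≤ K ∨ K ≤ H) ∧
    -- the asymptotic distribution of multilevel polarization
    (∀ {Ω : Type v} [MeasurableSpace Ω] (μ : Measure Ω) [IsProbabilityMeasure μ]
      (X : ℕ → Ω → G) (Y : ℕ → Ω → FiniteCoset G) (Q : Subgroup G → ℝ),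
      IsErasureSource X Y μ → HasCosetFrequencies Y μ Q → upperEntropyRate X Y μ < ∞ →
      ∀ (N : Subgroup G) [N.Normal] [Finite N] (δ : ℝ), 0 < δ → δ < Real.log p →
        Tendsto (fun n => liminf (fun m => polarizedFraction N X Y μ δ n m) atTop)
          atTop (𝓝 (Q N)) ∧
        Tendsto (fun n => limsup (fun m => polarizedFraction N X Y μ δ n m) atTop)
          atTop (𝓝 (Q N)) ∧
        -- for a stationary source the inner limits exist
        ((∀ i, IdentDistrib (fun ω => (X i ω, Y i ω)) (fun ω => (X 0 ω, Y 0 ω)) μ μ) →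
          ∃ l : ℕ → ℝ,
            (∀ n, Tendsto (fun m => polarizedFraction N X Y μ δ n m) atTop (𝓝 (l n))) ∧
            Tendsto l atTop (𝓝 (Q N)))) ∧
    -- there are countably infinitely many levels, and they can all have positive mass
    ({N : Subgroup G | N.Normal ∧ Finite N}.Countable ∧
      {N : Subgroup G | N.Normal ∧ Finite N}.Infinite ∧
      ∃ (Ω : Type u) (_ : MeasurableSpace Ω) (μ : Measure Ω) (_ : IsProbabilityMeasure μ)
        (X : ℕ → Ω → G) (Y : ℕ → Ω → FiniteCoset G) (Q : Subgroup G → ℝ),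
        IsErasureSource X Y μ ∧ HasCosetFrequencies Y μ Q ∧ upperEntropyRate X Y μ < ∞ ∧
        ∀ N : Subgroup G, N.Normal → Finite N → 0 < Q N) := by
  obtain ⟨I, hI⟩ : ∃ I : CommGroup G, I.toGroup = ‹Group G› :=
    ⟨{ ‹Group G› with
        mul_comm := fun a b => e.injective (by rw [map_mul, map_mul, mul_comm]) }, rfl⟩
  subst hI
  have hG := isPruferGroup_of_mulEquiv e
  refine ⟨hG.le_or_le, ?_, hG.countable_finite_subgroups, hG.infinite_finite_subgroups,
    exists_source_all_levels hG⟩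
  intro Ω _ μ _ X Y Q hs hQ hrate N _ _ δ hδ hδp
  obtain ⟨k, rfl⟩ := hG.exists_eq_primeTorsion N
  exact hs.tendsto_polarizedFraction hG hQ hrate k hδ hδp
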